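/- Throughout, a Jordan disk is an open simply connected subset of $\mathbb{C}$ whose topological boundary is a Jordan curve, and "component" means connected component. A holomorphic map $F\colon\mathcal U\to\mathcal V$ between open sets $\mathcal U\subset\mathcal V\subset\mathbb{C}$ is a complex box mapping if 1. $F$ has finitely many critical points; 2. $\mathcal V$ is the union of finitely many Jordan disks with disjoint closures; 3. every component $V$ of $\mathcal V$ is either a component of $\mathcal U$, or $V\cap\mathcal U$ is a union of Jordan disks with pairwise disjoint closures, each of which has its closure contained in $V$; 4. for every component $U$ of $\mathcal U$ the image $F(U)$ is a component of $\mathcal V$, and $F\colon U\to F(U)$ is proper. $F$ satisfies the no permutation condition if for every component $U$ of $\mathcal U$ there is $n\ge 0$ with $F^n(U)\setminus\mathcal U\neq\emptyset$. Put $K(F)=\bigcap_{n\ge 0}F^{-n}(\mathcal V)$ (the points whose whole forward orbit is defined). A puzzle piece of $F$ is a component of $F^{-n}(\mathcal V)$ for some $n\ge 0$. The fiber of a point is the intersection of all puzzle pieces containing it; a fiber $\mathcal F$ of a critical point $c\in K(F)$ is called a recurrent critical fiber if there are iterates $n_i\to\infty$ such that some limit point of the sets $F^{n_i}(\mathcal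 F)$ (that is, a limit point of some sequence of points $x_i\in F^{n_i}(\mathcal F)$) lies in $\mathcal F$. A set $Y\subseteq\mathcal U$ is forward invariant if $F(Y)\subseteq Y$. A sequence converges to a set if its distance to the set tends to $0$ (no sequence converges to the empty set). **Lemma (Ergodic property of general box mappings).** Let $F\colon\mathcal U\to\mathcal V$ be a complex box mapping that satisfies the no permutation condition, and let $\mathcal C$ be the union of the recurrent critical fibers of $F$. Define $$X_1=\{z\in K(F): F^i(z)\to\partial\mathcal V \text{ as } i\to\infty\},$$ $$X_2=\{z\in K(F): F^{i_j}(z)\to\mathcal C\text{ for some sequence } i_j\to\infty\},$$ and $X=K(F)\setminus(X_1\cup X_2)$. Then $X$ is forward invariant. Moreover, if $X'\subseteq X$ is a forward invariant (Lebesgue measurable) set of positive Lebesgue measure, then there exists a puzzle piece $J$ of $F$ such that $\operatorname{area}(J\cap X')=\operatorname{area}(J)$. -/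

import Mathlib

open Set Filter Topology MeasureTheory
open scoped ENNReal

namespace BoxMap

/-- `C` is a (nonempty) connected component of the set `S ⊆ ℂ`. -/
def IsComponent (C S : Set ℂ) : Prop :=
  ∃ x ∈ S, C = connectedComponentIn S x

/-- A Jordan curve in the plane: the image of the unit circle under a continuous injection. -/
def IsJordanCurve (γ : Set ℂ) : Prop :=
  ∃ f : Circle → ℂ, Continuous f ∧ Function.Injective f ∧ range f = γ

/-- A Jordan disk: an open simply connected subset of the plane whose topological boundary is a
Jordan curve. -/
structure IsJordanDisk (D : Set ℂ) : Prop where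
  isOpen : IsOpen D
  isSimplyConnected : IsSimplyConnected D
  frontier : IsJordanCurve (frontier D)

/-- The critical points of the holomorphic map `F : U → V`. -/
def critPoints (F : ℂ → ℂ) (U : Set ℂ) : Set ℂ :=
  {z | z ∈ U ∧ deriv F z = 0}

/-- `F : U → V` is a complex box mapping. The map is given by a function `F : ℂ → ℂ` of which
only the values on `U` matter. -/
structure IsComplexBoxMapping (F : ℂ → ℂ) (U V : Set ℂ) : Prop where
  isOpen_dom : IsOpen U
  isOpen_codom : IsOpen V
  subset : U ⊆ V
  mapsTo : MapsTo F U V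
  holomorphic : DifferentiableOn ℂ F U
  /-- there are finitely many critical points -/
  finite_crit : (critPoints F U).Finite
  /-- `V` has finitely many components ... -/
  finite_components : {W : Set ℂ | IsComponent W V}.Finite
  /-- ... which are Jordan disks ... -/
  jordan_codom : ∀ W, IsComponent W V → IsJordanDisk W
  /-- ... with disjoint closures -/
  disjoint_codom : ∀ W W', IsComponent W V → IsComponent W' V → W ≠ W' →
    Disjoint (closure W) (closure W')
  /-- a component `W` of `V` either is a component of `U`, or the components of `U` in `W` are
  Jordan disks with pairwise disjoint closures, compactly contained in `W` -/
  components : ∀ W, IsComponent W V → IsComponent W U ∨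
    ((∀ C, IsComponent C U → C ⊆ W → IsJordanDisk C ∧ closure C ⊆ W) ∧
      ∀ C C', IsComponent C U → IsComponent C' U → C ⊆ W → C' ⊆ W → C ≠ C' →
        Disjoint (closure C) (closure C'))
  /-- each component of `U` is mapped onto a component of `V` ... -/
  image_component : ∀ C, IsComponent C U → IsComponent (F '' C) V
  /-- ... and `F : C → F(C)` is proper -/
  proper : ∀ C, IsComponent C U → ∀ K ⊆ F '' C, IsCompact K → IsCompact (C ∩ F ⁻¹' K)

/-- The no permutation condition: every component `C` of `U` has an iterate `Fⁿ(C)` that is not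
contained in `U`. (If `F^[n] z ∉ U` and `n` is least with this property, then `F^[n] z` only
involves values of `F` on `U`, so that it is the true iterate of the partial map `F : U → V`.) -/
def NoPermutation (F : ℂ → ℂ) (U : Set ℂ) : Prop :=
  ∀ C, IsComponent C U → ∃ n : ℕ, ∃ z ∈ C, F^[n] z ∉ U

/-- The set `F⁻ⁿ(V)` for the partial map `F : U → V`: the points `z` for which `Fⁿ(z)` is defined
(and hence lies in `V`). -/
def iterPreimage (F : ℂ → ℂ) (U V : Set ℂ) : ℕ → Set ℂ
  | 0 => V
  | n + 1 => U ∩ F ⁻¹' iterPreimage F U V n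

/-- The filled Julia set `K(F)`, the set of non-escaping points. -/
def filledJulia (F : ℂ → ℂ) (U V : Set ℂ) : Set ℂ :=
  ⋂ n : ℕ, iterPreimage F U V n

/-- `P` is a puzzle piece (of some depth `n`) of `F`. -/
def IsPuzzlePiece (F : ℂ → ℂ) (U V : Set ℂ) (P : Set ℂ) : Prop :=
  ∃ n : ℕ, IsComponent P (iterPreimage F U V n)

/-- The fiber of `x`: the intersection of all puzzle pieces containing `x`. -/
def fiber (F : ℂ → ℂ) (U V : Set ℂ) (x : ℂ) : Set ℂ :=
  ⋂₀ {P | IsPuzzlePiece F U V P ∧ x ∈ P}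

/-- `A` is a recurrent critical fiber: it is the fiber of a critical point `c`, all iterates are
defined on it (`c` does not escape), and for some iterates `n i → ∞` some limit point of the
sets `F^{n i}(A)` lies in `A`. -/
def IsRecurrentCriticalFiber (F : ℂ → ℂ) (U V : Set ℂ) (A : Set ℂ) : Prop :=
  (∃ c ∈ critPoints F U, c ∈ filledJulia F U V ∧ A = fiber F U V c) ∧
    ∃ n : ℕ → ℕ, Tendsto n atTop atTop ∧
      ∃ x : ℕ → ℂ, (∀ i, x i ∈ A) ∧ ∃ y ∈ A, MapClusterPt y atTop fun i => F^[n i] (x i)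

/-- The union of all recurrent critical fibers. -/
def recurrentFibers (F : ℂ → ℂ) (U V : Set ℂ) : Set ℂ :=
  ⋃₀ {A | IsRecurrentCriticalFiber F U V A}

/-- The sequence `u` converges to the set `A`: its distance to `A` tends to zero. The distance to
the empty set is `∞`, so that nothing converges to the empty set. -/
def ConvergesToSet (u : ℕ → ℂ) (A : Set ℂ) : Prop :=
  Tendsto (fun i => Metric.infEDist (u i) A) atTop (𝓝 0)

/-- The non-escaping points whose orbit converges to the boundary of `V`. -/
def boundaryPoints (F : ℂ → ℂ) (U V : Set ℂ) : Set ℂ :=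
  {z | z ∈ filledJulia F U V ∧ ConvergesToSet (fun i => F^[i] z) (frontier V)}

/-- The non-escaping points whose orbit converges to the union of the recurrent critical fibers
along some sequence of times. -/
def recurrentPoints (F : ℂ → ℂ) (U V : Set ℂ) : Set ℂ :=
  {z | z ∈ filledJulia F U V ∧ ∃ i : ℕ → ℕ, Tendsto i atTop atTop ∧
    ConvergesToSet (fun j => F^[i j] z) (recurrentFibers F U V)}

/-- The non-escaping points that neither converge to the boundary of `V` nor accumulate on
recurrent critical fibers. -/
def ergodicSet (F : ℂ → ℂ) (U V : Set ℂ) : Set ℂ :=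
  filledJulia F U V \ (boundaryPoints F U V ∪ recurrentPoints F U V)

end BoxMap

/-! Forward invariance only shifts sequences of times. For the second claim, blow up a Lebesgue
density point `z` of the invariant set along its orbit. An orbit in the ergodic set meets the fiber
of a non-escaping critical point at most once, since a second visit would make the fiber recurrent
and visited infinitely often. Pullbacks of null sets are null, so `z` can be chosen with an orbit
that avoids all these fibers (`volume_avoidsCriticalFibers_ne_zero`).

Suppose the orbit of `z` accumulates at `y`, and a fixed disk at `y` pulls back to `z` without
branching at infinitely many times `k`. The inverse branches have bounded distortion by Koebe-type
estimates and live at scale `|(F^k)'(z)|⁻¹`. This scale tends to `0`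
(`tendsto_deriv_inverseBranch`): otherwise a fixed disk would lie in `K(F)`, and some fiber with
interior would return to itself without critical points, against `not_ball_subset_fiber`. Density at
`z` is thus transported to full measure near `y`. A chain of disks carries the comparison of scales
over the whole puzzle piece, minus a finite set of branch values
(`volume_diff_eq_zero_of_comparablePreimage`).

It remains to find the disk. If the orbit enters every piece around some non-escaping critical
point, accumulation of critical orbits on such critical fibers is a transitive relation on a finite
set. It is irreflexive because `z` does not accumulate on recurrent fibers. A fiber that is minimal
for it has a deep piece with unbranched pullbacks. Otherwise branching occurs only a bounded number
of steps before arrival. If every disk at every limit point in `V` failed, limit points could be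
traced back to critical limit points surviving ever longer, which is impossible; a limit point in
`V` exists because the orbit does not converge to the boundary. -/

/-! ### Lifting through proper unbranched holomorphic maps. -/

theorem isLocalHomeomorphOn_of_deriv_ne_zero {A : Set ℂ} {G : ℂ → ℂ} (hA : IsOpen A)
    (hG : DifferentiableOn ℂ G A) (hcrit : ∀ x ∈ A, deriv G x ≠ 0) :
    IsLocalHomeomorphOn G A := by
  intro x hx
  have hs : HasStrictDerivAt G (deriv G x) x :=
    (hG.analyticAt (hA.mem_nhds hx)).hasStrictDerivAt
  exact ⟨(hs.hasStrictFDerivAt_equiv (hcrit x hx)).toOpenPartialHomeomorph G,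
    (hs.hasStrictFDerivAt_equiv (hcrit x hx)).mem_toOpenPartialHomeomorph_source, rfl⟩

/-- Properness makes the map closed with compact fibers; these are also discrete, hence finite. A
closed local homeomorphism with finite fibers is a covering. -/
theorem isCoveringMap_restrict_of_proper {A Q : Set ℂ} {G : ℂ → ℂ} (hA : IsOpen A)
    (hQ : IsOpen Q) (hG : DifferentiableOn ℂ G A) (hmaps : MapsTo G A Q)
    (hcrit : ∀ x ∈ A, deriv G x ≠ 0)
    (hproper : ∀ K ⊆ Q, IsCompact K → IsCompact (A ∩ G ⁻¹' K)) :
    IsCoveringMap (hmaps.restrict G A Q) := by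
  have hcont : Continuous (hmaps.restrict G A Q) := hG.continuousOn.mapsToRestrict hmaps
  have hloc : IsLocalHomeomorph (hmaps.restrict G A Q) := by
    refine IsLocalHomeomorph.of_comp (g := ((↑) : Q → ℂ))
      ?_ hQ.isOpenEmbedding_subtypeVal.isLocalHomeomorph hcont
    rw [isLocalHomeomorph_iff_isLocalHomeomorphOn_univ]
    have h1 : IsLocalHomeomorphOn ((↑) : A → ℂ) univ :=
      isLocalHomeomorph_iff_isLocalHomeomorphOn_univ.mp
        hA.isOpenEmbedding_subtypeVal.isLocalHomeomorph
    exact (isLocalHomeomorphOn_of_deriv_ne_zero hA hG hcrit).comp h1 (fun x _ => x.2)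
  have : LocallyCompactSpace Q := hQ.locallyCompactSpace
  have hcpt : ∀ K : Set Q, IsCompact K → IsCompact (hmaps.restrict G A Q ⁻¹' K) := by
    intro K hK
    have h1 := hproper ((↑) '' K) (by rintro _ ⟨q, -, rfl⟩; exact q.2)
      (hK.image continuous_subtype_val)
    rw [Topology.IsEmbedding.subtypeVal.isCompact_iff]
    convert h1 using 1
    ext x
    constructor
    · rintro ⟨a, ha, rfl⟩
      exact ⟨a.2, _, ha, rfl⟩
    · rintro ⟨hx, q, hq, hqx⟩
      refine ⟨⟨x, hx⟩, ?_, rfl⟩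
      have : hmaps.restrict G A Q ⟨x, hx⟩ = q := Subtype.ext hqx.symm
      rwa [mem_preimage, this]
  have hprop : IsProperMap (hmaps.restrict G A Q) :=
    isProperMap_iff_isCompact_preimage.mpr ⟨hcont, fun K hK => hcpt K hK⟩
  rw [isCoveringMap_iff_isCoveringMapOn_univ]
  refine hprop.isClosedMap.isCoveringMapOn_of_isLocalHomeomorphOn (fun x _ => ?_) ?_
  · exact (hcpt {x} isCompact_singleton).finite
      (IsDiscrete.of_openPartialHomeomorph _ subset_rfl fun e _ => by
        obtain ⟨φ, h1, h2⟩ := hloc e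
        exact ⟨φ, h1, h2.symm⟩)
  · rw [preimage_univ]
    exact isLocalHomeomorph_iff_isLocalHomeomorphOn_univ.mp hloc

/-- Holomorphic maps from a disk lift through proper holomorphic maps without critical points. -/
theorem exists_holomorphic_lift {A Q : Set ℂ} {G f : ℂ → ℂ} (hA : IsOpen A)
    (hQ : IsOpen Q) (hG : DifferentiableOn ℂ G A) (hmaps : MapsTo G A Q)
    (hcrit : ∀ x ∈ A, deriv G x ≠ 0)
    (hproper : ∀ K ⊆ Q, IsCompact K → IsCompact (A ∩ G ⁻¹' K))
    {c : ℂ} {R : ℝ} (hR : 0 < R) (hf : DifferentiableOn ℂ f (Metric.ball c R))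
    (hfQ : MapsTo f (Metric.ball c R) Q) {x : ℂ} (hx : x ∈ A) (hGx : G x = f c) :
    ∃ h : ℂ → ℂ, DifferentiableOn ℂ h (Metric.ball c R) ∧ MapsTo h (Metric.ball c R) A ∧
      (∀ w ∈ Metric.ball c R, G (h w) = f w) ∧ h c = x := by
  classical
  have cov := isCoveringMap_restrict_of_proper hA hQ hG hmaps hcrit hproper
  have hc : c ∈ Metric.ball c R := Metric.mem_ball_self hR
  have : ContractibleSpace (Metric.ball c R) :=
    (convex_ball c R).contractibleSpace ⟨c, hc⟩
  have : LocallyPathConnectedSpace (Metric.ball c R) :=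
    Metric.isOpen_ball.locallyPathConnectedSpace
  obtain ⟨g, ⟨hg0, hg⟩, -⟩ := cov.existsUnique_continuousMap_lifts
    ⟨hfQ.restrict f _ Q, hf.continuousOn.mapsToRestrict hfQ⟩ ⟨c, hc⟩ ⟨x, hx⟩ (Subtype.ext hGx)
  have hg' : ∀ w : Metric.ball c R, G (g w) = f w := fun w => congrArg Subtype.val (congrFun hg w)
  let h : ℂ → ℂ := fun w => if hw : w ∈ Metric.ball c R then (g ⟨w, hw⟩ : ℂ) else 0
  have hh : ∀ w : Metric.ball c R, h w = g w := fun w => by simp only [h, w.2, dif_pos]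
  have hcont : ContinuousOn h (Metric.ball c R) := by
    rw [continuousOn_iff_continuous_domRestrict]
    convert continuous_subtype_val.comp (map_continuous g) using 1
    ext w
    exact hh w
  refine ⟨h, ?_, fun w hw => ?_, fun w hw => ?_, ?_⟩
  · intro w hw
    have hwA : h w ∈ A := by rw [hh ⟨w, hw⟩]; exact (g _).2
    have hs : HasStrictDerivAt G (deriv G (h w)) (h w) :=
      (hG.analyticAt (hA.mem_nhds hwA)).hasStrictDerivAt
    have hne := hcrit _ hwA
    have hfw : f w = G (h w) := by rw [hh ⟨w, hw⟩, hg' ⟨w, hw⟩]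
    have hinv := hs.to_localInverse hne
    have hbw : Metric.ball c R ∈ 𝓝 w := Metric.isOpen_ball.mem_nhds hw
    have hcw : ContinuousAt h w := hcont.continuousAt hbw
    -- The continuous lift agrees near `w` with the local inverse of `G` composed with `f`, hence is
    -- holomorphic.
    have hev : ∀ᶠ v in 𝓝 w, h v = (hs.localInverse G (deriv G (h w)) (h w) hne) (f v) := by
      have h1 := hcw.eventually (hs.hasStrictFDerivAt_equiv hne).eventually_left_inverse
      filter_upwards [h1, hbw] with v hv hvb
      rw [← hg' ⟨v, hvb⟩, ← hh ⟨v, hvb⟩]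
      exact hv.symm
    have hd : DifferentiableAt ℂ
        (fun v => (hs.localInverse G (deriv G (h w)) (h w) hne) (f v)) w := by
      have h2 := hinv.hasDerivAt.differentiableAt
      rw [← hfw] at h2
      exact h2.comp w (hf.differentiableAt hbw)
    exact (hd.congr_of_eventuallyEq hev).differentiableWithinAt
  · rw [hh ⟨w, hw⟩]; exact (g _).2
  · rw [hh ⟨w, hw⟩]; exact hg' ⟨w, hw⟩
  · rw [hh ⟨c, hc⟩, hg0]

/-! ### Koebe-type estimates for univalent maps. -/

theorem deriv_mul_deriv_of_leftInverse {φ g : ℂ → ℂ} {B : Set ℂ} (hB : IsOpen B)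
    (hφ : DifferentiableOn ℂ φ B) (hg : ∀ w ∈ B, DifferentiableAt ℂ g (φ w))
    (hgφ : ∀ w ∈ B, g (φ w) = w) {w : ℂ} (hw : w ∈ B) :
    deriv g (φ w) * deriv φ w = 1 := by
  have h1 := (hg w hw).hasDerivAt.comp w (hφ.differentiableAt (hB.mem_nhds hw)).hasDerivAt
  have h2 : HasDerivAt (g ∘ φ) 1 w :=
    (hasDerivAt_id w).congr_of_eventuallyEq (by
      filter_upwards [hB.mem_nhds hw] with v hv using hgφ v hv)
  exact h1.unique h2

theorem isOpen_image_of_deriv_ne_zero {φ : ℂ → ℂ} {B : Set ℂ} (hB : IsOpen B)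
    (hφ : DifferentiableOn ℂ φ B) (hne : ∀ w ∈ B, deriv φ w ≠ 0) : IsOpen (φ '' B) := by
  rw [isOpen_iff_mem_nhds]
  rintro _ ⟨w, hw, rfl⟩
  have hs : HasStrictDerivAt φ (deriv φ w) w :=
    (hφ.analyticAt (hB.mem_nhds hw)).hasStrictDerivAt
  rw [← hs.map_nhds_eq (hne w hw)]
  exact image_mem_map (hB.mem_nhds hw)

/-- Squaring is a proper unbranched self-map of the punctured plane, so a square root is a lift
through it. -/
theorem exists_holomorphic_sqrt {f : ℂ → ℂ} {c : ℂ} {R : ℝ} (hR : 0 < R)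
    (hf : DifferentiableOn ℂ f (Metric.ball c R)) (hf0 : ∀ w ∈ Metric.ball c R, f w ≠ 0) :
    ∃ s : ℂ → ℂ, DifferentiableOn ℂ s (Metric.ball c R) ∧
      ∀ w ∈ Metric.ball c R, s w ^ 2 = f w := by
  obtain ⟨x, hx⟩ : ∃ x : ℂ, x ^ 2 = f c := IsAlgClosed.exists_pow_nat_eq (f c) two_pos
  have hx0 : x ≠ 0 := by
    rintro rfl
    exact hf0 c (Metric.mem_ball_self hR) (by rw [← hx]; simp)
  obtain ⟨s, hs, -, hs2, -⟩ := exists_holomorphic_lift (A := {0}ᶜ) (Q := {0}ᶜ)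
    (G := fun z => z ^ 2) isOpen_compl_singleton isOpen_compl_singleton
    (by fun_prop) (fun z hz => by simpa using hz) (fun z hz => by simpa using hz)
    (fun K hK hKc => by
      have h1 : ({0}ᶜ : Set ℂ) ∩ (fun z => z ^ 2) ⁻¹' K = (fun z : ℂ => z ^ 2) ⁻¹' K := by
        ext z
        simp only [mem_inter_iff, mem_compl_iff, mem_singleton_iff, mem_preimage,
          and_iff_right_iff_imp]
        rintro hz rfl
        exact hK hz (by simp)
      rw [h1]
      refine Metric.isCompact_of_isClosed_isBounded (hKc.isClosed.preimage (by fun_prop)) ?_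
      obtain ⟨M, hM⟩ := hKc.isBounded.exists_norm_le
      refine isBounded_iff_forall_norm_le.mpr ⟨M + 1, fun z hz => ?_⟩
      have h2 := hM _ hz
      simp only [norm_pow] at h2
      nlinarith [norm_nonneg z, sq_nonneg (‖z‖ - 1)])
    hR hf (fun w hw => hf0 w hw) (x := x) hx0 hx
  exact ⟨s, hs, hs2⟩

/-- A covering and growth theorem for univalent functions on a disk, in the spirit of the Koebe
theorems. -/
theorem exists_ball_subset_image_of_univalent {φ g : ℂ → ℂ} {c : ℂ} {R : ℝ} (hR : 0 < R)
    (hφ : DifferentiableOn ℂ φ (Metric.ball c R))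
    (hg : ∀ w ∈ Metric.ball c R, DifferentiableAt ℂ g (φ w))
    (hgφ : ∀ w ∈ Metric.ball c R, g (φ w) = w)
    (hne : (φ '' Metric.ball c R)ᶜ.Nonempty) :
    ∃ d > 0, Metric.ball (φ c) d ⊆ φ '' Metric.ball c R ∧ d ≤ R * ‖deriv φ c‖ ∧
      ∀ x ∈ Metric.ball c (R / 18), ‖φ x - φ c‖ ≤ 26 * d := by
  set B := Metric.ball c R with hBdef
  have hcB : c ∈ B := Metric.mem_ball_self hR
  have hB : IsOpen B := Metric.isOpen_ball
  have hprod := fun w hw => deriv_mul_deriv_of_leftInverse hB hφ hg hgφ (w := w) hw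
  have hΩ : IsOpen (φ '' B) := isOpen_image_of_deriv_ne_zero hB hφ
    (fun w hw h0 => by simpa [h0] using hprod w hw)
  -- `a` is an omitted value nearest to `φ c`; its distance `q ^ 2` will be the radius `d`.
  obtain ⟨a, ha, had⟩ := hΩ.isClosed_compl.exists_infDist_eq_dist hne (φ c)
  have hball : Metric.ball (φ c) (dist (φ c) a) ⊆ φ '' B := by
    intro v hv
    by_contra hvn
    have := Metric.infDist_le_dist_of_mem (x := φ c) (show v ∈ (φ '' B)ᶜ from hvn)
    rw [had, dist_comm (φ c) v] at this
    exact absurd hv (by simpa using this)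
  obtain ⟨s, hs, hs2⟩ := exists_holomorphic_sqrt (f := fun w => φ w - a) hR
    (hφ.sub_const a) (fun w hw h0 => ha ⟨w, hw, sub_eq_zero.mp h0⟩)
  have hs0 : ∀ w ∈ B, s w ≠ 0 := fun w hw h0 => ha ⟨w, hw, by
    have := hs2 w hw
    rw [h0] at this
    simpa using (sub_eq_zero.mp (by simpa using this.symm))⟩
  set q := ‖s c‖ with hq
  have hq0 : 0 < q := norm_pos_iff.mpr (hs0 c hcB)
  have hd : dist (φ c) a = q ^ 2 := by
    rw [hq, ← norm_pow, hs2 c hcB, dist_eq_norm]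
  rw [hd] at hball
  -- the inverse branch of the square root
  have hmem : ∀ u ∈ Metric.ball (s c) (q / 4), u ^ 2 + a ∈ Metric.ball (φ c) (q ^ 2) := by
    intro u hu
    have h1 : ‖u - s c‖ < q / 4 := by simpa [dist_eq_norm] using hu
    have h2 : u ^ 2 + a - φ c = (u - s c) * (u - s c + 2 * s c) := by
      have := hs2 c hcB
      linear_combination this
    have h3 : ‖u - s c + 2 * s c‖ ≤ q / 4 + 2 * q := by
      refine (norm_add_le _ _).trans ?_
      rw [norm_mul]
      simp only [Complex.norm_ofNat]
      linarith
    rw [Metric.mem_ball, dist_eq_norm, h2, norm_mul]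
    nlinarith [norm_nonneg (u - s c), norm_nonneg (u - s c + 2 * s c)]
  have hgB : ∀ v ∈ Metric.ball (φ c) (q ^ 2), g v ∈ B ∧ φ (g v) = v := by
    intro v hv
    obtain ⟨w, hw, rfl⟩ := hball hv
    rw [hgφ w hw]
    exact ⟨hw, rfl⟩
  have hgd : DifferentiableOn ℂ g (Metric.ball (φ c) (q ^ 2)) := by
    intro v hv
    obtain ⟨w, hw, rfl⟩ := hball hv
    exact (hg w hw).differentiableWithinAt
  have hgc : g (φ c) = c := hgφ c hcB
  have hinv : ∀ u ∈ Metric.ball (s c) (q / 4), s (g (u ^ 2 + a)) = u := by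
    have hc1 : ContinuousOn (fun u => s (g (u ^ 2 + a))) (Metric.ball (s c) (q / 4)) :=
      hs.continuousOn.comp (hgd.continuousOn.comp (by fun_prop) hmem)
        (fun u hu => (hgB _ (hmem u hu)).1)
    refine (convex_ball (s c) (q / 4)).isPreconnected.eq_of_sq_eq hc1 continuousOn_id
      (fun u hu => ?_) (fun {u} hu h0 => ?_) (y := s c) (Metric.mem_ball_self (by linarith)) ?_
    · have h1 := hgB _ (hmem u hu)
      have h2 := hs2 _ h1.1
      simp only [Pi.pow_apply]
      rw [h2, h1.2]
      ring
    · have h0' : u = 0 := h0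
      rw [h0'] at hu
      simp only [Metric.mem_ball, dist_zero_left] at hu
      linarith
    · have h1 : s c ^ 2 + a = φ c := by rw [hs2 c hcB]; ring
      change s (g (s c ^ 2 + a)) = s c
      rw [h1, hgc]
  -- A square root of an injective nonvanishing function never takes both `u` and `-u`. Since `s`
  -- takes every value within `q / 4` of `s c`, it omits the opposite disk about `-s c`.
  have hlow : ∀ w ∈ B, q / 4 ≤ ‖s w + s c‖ := by
    intro w hw
    by_contra hlt
    push Not at hlt
    have hu : -s w ∈ Metric.ball (s c) (q / 4) := by
      have e : -s w - s c = -(s w + s c) := by ring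
      rwa [Metric.mem_ball, dist_eq_norm, e, norm_neg]
    have h1 := hinv _ hu
    have h2 : (-s w) ^ 2 + a = φ w := by rw [neg_sq, hs2 w hw]; ring
    rw [h2, hgφ w hw] at h1
    exact hs0 w hw (self_eq_neg.mp h1)
  -- Because of the omitted disk, `1 / (s + s c)` is bounded and the Schwarz lemma applies to it.
  -- The range radius is `4 / q + 1 / (2 * q) = 9 / (2 * q)`, and on the disk of radius `R / 18` the
  -- function moves by at most half of its central modulus `1 / (2 * q)`.
  have hk : DifferentiableOn ℂ (fun w => (s w + s c)⁻¹) B :=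
    (hs.add_const _).inv (fun w hw h0 => by
      have := hlow w hw
      rw [h0, norm_zero] at this
      linarith)
  have hkb : ∀ w ∈ B, ‖(s w + s c)⁻¹‖ ≤ 4 / q := by
    intro w hw
    rw [norm_inv, show 4 / q = (q / 4)⁻¹ by field_simp]
    exact inv_anti₀ (by positivity) (hlow w hw)
  have hkc : ‖(s c + s c)⁻¹‖ = 1 / (2 * q) := by
    rw [← two_mul, norm_inv, norm_mul]
    simp
    ring
  have hkm : MapsTo (fun w => (s w + s c)⁻¹) (Metric.ball c R)
      (Metric.closedBall ((s c + s c)⁻¹) (9 / (2 * q))) := by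
    intro w hw
    rw [Metric.mem_closedBall, dist_eq_norm]
    refine (norm_sub_le _ _).trans ?_
    rw [hkc]
    refine (add_le_add_left (hkb w hw) _).trans (le_of_eq ?_)
    field_simp
    norm_num
  have h6 : ‖deriv g (φ c)‖ ≤ R / q ^ 2 := by
    refine Complex.norm_deriv_le_div_of_mapsTo_ball hgd (fun v hv => ?_) (by positivity)
    rw [hgc]
    exact Metric.ball_subset_closedBall (hgB v hv).1
  have h7 : 1 ≤ R / q ^ 2 * ‖deriv φ c‖ := by
    have := congrArg norm (hprod c hcB)
    rw [norm_mul, norm_one] at this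
    rw [← this]
    gcongr
  have h8 : q ^ 2 ≤ R * ‖deriv φ c‖ := by
    rw [div_mul_eq_mul_div, le_div_iff₀ (by positivity)] at h7
    linarith
  refine ⟨q ^ 2, by positivity, hball, h8, fun x hx => ?_⟩
  have hxB : x ∈ B := Metric.ball_subset_ball (by linarith) hx
  have hsch := Complex.dist_le_div_mul_dist_of_mapsTo_ball hk hkm hxB
  have hxd : dist x c ≤ R / 18 := le_of_lt hx
  have h1 : dist ((s x + s c)⁻¹) ((s c + s c)⁻¹) ≤ 1 / (4 * q) := by
    refine hsch.trans ?_
    calc 9 / (2 * q) / R * dist x c ≤ 9 / (2 * q) / R * (R / 18) := by gcongr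
      _ = 1 / (4 * q) := by field_simp; norm_num
  have h2 : 1 / (4 * q) ≤ ‖(s x + s c)⁻¹‖ := by
    have h3 : ‖(s c + s c)⁻¹‖ ≤ ‖(s x + s c)⁻¹‖ + dist ((s x + s c)⁻¹) ((s c + s c)⁻¹) := by
      rw [dist_eq_norm, ← norm_neg ((s x + s c)⁻¹ - _)]
      refine le_trans (le_of_eq ?_) (norm_add_le _ _)
      congr 1
      ring
    rw [hkc] at h3
    have h4 : 1 / (2 * q) = 1 / (4 * q) + 1 / (4 * q) := by field_simp; norm_num
    linarith
  have h3 : ‖s x + s c‖ ≤ 4 * q := by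
    rw [norm_inv, one_div] at h2
    exact (inv_le_inv₀ (by positivity)
      (lt_of_lt_of_le (by positivity) (hlow x hxB))).mp h2
  have h4 : ‖s x‖ ≤ 5 * q := by
    have : s x = (s x + s c) - s c := by ring
    rw [this]
    exact (norm_sub_le _ _).trans (by linarith)
  have e : φ x - φ c = s x ^ 2 - s c ^ 2 := by
    rw [hs2 x hxB, hs2 c hcB]; ring
  rw [e]
  refine (norm_sub_le _ _).trans ?_
  rw [norm_pow, norm_pow, ← hq]
  nlinarith [norm_nonneg (s x)]

theorem norm_sub_le_of_univalent {φ g : ℂ → ℂ} {c : ℂ} {R : ℝ} (hR : 0 < R)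
    (hφ : DifferentiableOn ℂ φ (Metric.ball c R))
    (hg : ∀ w ∈ Metric.ball c R, DifferentiableAt ℂ g (φ w))
    (hgφ : ∀ w ∈ Metric.ball c R, g (φ w) = w)
    (hne : (φ '' Metric.ball c R)ᶜ.Nonempty) {x : ℂ} (hx : x ∈ Metric.ball c (R / 18)) :
    ‖φ x - φ c‖ ≤ 26 * R * ‖deriv φ c‖ := by
  obtain ⟨d, -, -, hd, h⟩ := exists_ball_subset_image_of_univalent hR hφ hg hgφ hne
  linarith [h x hx]

/-- The growth bound `26 * d` and Cauchy's estimate on radius `R / 18` bound the covered radius `d`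
from below; `468 = 26 * 18`. -/
theorem ball_subset_image_of_univalent {φ g : ℂ → ℂ} {c : ℂ} {R : ℝ} (hR : 0 < R)
    (hφ : DifferentiableOn ℂ φ (Metric.ball c R))
    (hg : ∀ w ∈ Metric.ball c R, DifferentiableAt ℂ g (φ w))
    (hgφ : ∀ w ∈ Metric.ball c R, g (φ w) = w)
    (hne : (φ '' Metric.ball c R)ᶜ.Nonempty) :
    Metric.ball (φ c) (R * ‖deriv φ c‖ / 468) ⊆ φ '' Metric.ball c R := by
  obtain ⟨d, hd0, hsub, -, h⟩ := exists_ball_subset_image_of_univalent hR hφ hg hgφ hne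
  refine (Metric.ball_subset_ball ?_).trans hsub
  have h1 : ‖deriv φ c‖ ≤ 26 * d / (R / 18) :=
    Complex.norm_deriv_le_div_of_mapsTo_ball
      (hφ.mono (Metric.ball_subset_ball (by linarith)))
      (fun x hx => by
        rw [Metric.mem_closedBall, dist_eq_norm]
        exact h x hx) (by positivity)
  rw [le_div_iff₀ (by positivity)] at h1
  linarith

theorem norm_deriv_le_of_univalent {φ g : ℂ → ℂ} {c : ℂ} {R : ℝ} (hR : 0 < R)
    (hφ : DifferentiableOn ℂ φ (Metric.ball c R))
    (hg : ∀ w ∈ Metric.ball c R, DifferentiableAt ℂ g (φ w))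
    (hgφ : ∀ w ∈ Metric.ball c R, g (φ w) = w)
    (hne : (φ '' Metric.ball c R)ᶜ.Nonempty) {x : ℂ} (hx : x ∈ Metric.ball c (R / 36)) :
    ‖deriv φ x‖ ≤ 1872 * ‖deriv φ c‖ := by
  have hsub : Metric.ball x (R / 36) ⊆ Metric.ball c (R / 18) := by
    refine Metric.ball_subset_ball' ?_
    have := Metric.mem_ball.mp hx
    linarith
  have hxx : x ∈ Metric.ball c (R / 18) := Metric.ball_subset_ball (by linarith) hx
  have h := Complex.norm_deriv_le_div_of_mapsTo_ball (f := φ) (c := x) (R₁ := R / 36)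
    (R₂ := 52 * R * ‖deriv φ c‖)
    (hφ.mono (hsub.trans (Metric.ball_subset_ball (by linarith)))) (fun v hv => ?_) (by positivity)
  · refine h.trans (le_of_eq ?_)
    field_simp
    ring
  · rw [Metric.mem_closedBall, dist_eq_norm]
    have h1 := norm_sub_le_of_univalent hR hφ hg hgφ hne (hsub hv)
    have h2 := norm_sub_le_of_univalent hR hφ hg hgφ hne hxx
    have e : φ v - φ x = (φ v - φ c) - (φ x - φ c) := by ring
    rw [e]
    exact (norm_sub_le _ _).trans (by linarith)

/-- The preceding bound with the roles of `c` and `x` exchanged, on the disk of radius `R / 2` about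
`x`. -/
theorem norm_deriv_center_le_of_univalent {φ g : ℂ → ℂ} {c : ℂ} {R : ℝ} (hR : 0 < R)
    (hφ : DifferentiableOn ℂ φ (Metric.ball c R))
    (hg : ∀ w ∈ Metric.ball c R, DifferentiableAt ℂ g (φ w))
    (hgφ : ∀ w ∈ Metric.ball c R, g (φ w) = w)
    (hne : (φ '' Metric.ball c R)ᶜ.Nonempty) {x : ℂ} (hx : x ∈ Metric.ball c (R / 72)) :
    ‖deriv φ c‖ ≤ 1872 * ‖deriv φ x‖ := by
  have hsub : Metric.ball x (R / 2) ⊆ Metric.ball c R := by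
    refine Metric.ball_subset_ball' ?_
    have := Metric.mem_ball.mp hx
    linarith
  refine norm_deriv_le_of_univalent (c := x) (R := R / 2) (by positivity) (hφ.mono hsub)
    (fun w hw => hg w (hsub hw)) (fun w hw => hgφ w (hsub hw))
    (hne.mono (compl_subset_compl.mpr (image_mono hsub))) ?_
  rw [Metric.mem_ball, dist_comm]
  have := Metric.mem_ball.mp hx
  linarith

/-! ### Plane topology. -/

theorem IsPreconnected.subset_of_disjoint_frontier {S D : Set ℂ} (hS : IsPreconnected S)
    (hD : IsOpen D) (hdisj : Disjoint S (frontier D)) (hne : (S ∩ D).Nonempty) : S ⊆ D := by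
  refine hS.subset_left_of_subset_union hD isClosed_closure.isOpen_compl
    (disjoint_compl_right_iff_subset.mpr subset_closure) (fun x hx => ?_) hne
  by_contra hcon
  simp only [mem_union, mem_compl_iff, not_or, not_not] at hcon
  exact hdisj.le_bot ⟨hx, by rw [hD.frontier_eq]; exact ⟨hcon.2, hcon.1⟩⟩

/-- Otherwise some circle about a frontier point `a` encloses the compact frontier and lies in `D`.
Simple connectivity gives a logarithm of `z - a` on `D`, so the integral of `1 / (z - a)` over this
circle would vanish instead of being `2πi`. -/
theorem BoxMap.isBounded_of_isJordanDisk {D : Set ℂ} (hD : BoxMap.IsJordanDisk D) :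
    Bornology.IsBounded D := by
  obtain ⟨f, hf, -, hrange⟩ := hD.frontier
  have hcpt : IsCompact (frontier D) := by rw [← hrange]; exact isCompact_range hf
  obtain ⟨a, ha⟩ : (frontier D).Nonempty := by rw [← hrange]; exact range_nonempty f
  have haD : a ∉ D := by
    rw [hD.isOpen.frontier_eq] at ha
    exact ha.2
  obtain ⟨M, hM⟩ := hcpt.isBounded.subset_closedBall a
  refine (Metric.isBounded_iff_subset_closedBall a).mpr ⟨max M 0, fun w hw => ?_⟩
  by_contra hlt
  simp only [Metric.mem_closedBall, not_le, max_lt_iff] at hlt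
  have hsub : Metric.sphere a (dist w a) ⊆ D := by
    refine (isPreconnected_sphere (by simp) a _).subset_of_disjoint_frontier hD.isOpen ?_
      ⟨w, Metric.mem_sphere.mpr rfl, hw⟩
    rw [Set.disjoint_left]
    intro x hx hxD
    have h1 := hM hxD
    rw [Metric.mem_closedBall, Metric.mem_sphere.mp hx] at h1
    linarith
  obtain ⟨l, hl, hexp⟩ := Complex.exists_continuousOn_eqOn_exp_comp hD.isSimplyConnected
    hD.isOpen (g := fun z => z - a) (by fun_prop) (by
      rintro ⟨z, hz, hza⟩
      exact haD (by rwa [← sub_eq_zero.mp hza]))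
  have hderiv : ∀ z ∈ D, HasDerivAt l (z - a)⁻¹ z := by
    intro z hz
    have h1 : Complex.exp (l z) = z - a := hexp hz
    have h2 : HasDerivAt (fun u => Complex.exp u + a) (z - a) (l z) := by
      rw [← h1]
      exact (Complex.hasDerivAt_exp _).add_const a
    refine h2.of_local_left_inverse (hl.continuousAt (hD.isOpen.mem_nhds hz))
      (fun h0 => haD (by rwa [← sub_eq_zero.mp h0])) ?_
    filter_upwards [hD.isOpen.mem_nhds hz] with v hv
    have h3 : Complex.exp (l v) = v - a := hexp hv
    rw [h3]
    ring
  have h0 := circleIntegral.integral_eq_zero_of_hasDerivWithinAt (dist_nonneg (x := w) (y := a))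
    (fun z hz => (hderiv z (hsub hz)).hasDerivWithinAt)
  rw [circleIntegral.integral_sub_center_inv a hlt.2.ne'] at h0
  exact Complex.two_pi_I_ne_zero h0

theorem isPreconnected_ball_diff_countable {E : Set ℂ} (hE : E.Countable) (c : ℂ) {r : ℝ}
    (hr : 0 < r) : IsPreconnected (Metric.ball c r \ E) := by
  set e := OpenPartialHomeomorph.univBall (E := ℂ) c r with he
  have hsrc : e.source = univ := OpenPartialHomeomorph.univBall_source c r
  have htgt : e.target = Metric.ball c r := OpenPartialHomeomorph.univBall_target c hr
  have hinj : InjOn e univ := by rw [← hsrc]; exact e.injOn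
  have h1 : (e ⁻¹' E).Countable := hE.preimage_of_injOn (hinj.mono (subset_univ _))
  have h2 := (h1.isConnected_compl_of_one_lt_rank (E := ℂ) (by simp)).isPreconnected.image e
    (OpenPartialHomeomorph.continuous_univBall c r).continuousOn
  convert h2 using 1
  ext x
  constructor
  · rintro ⟨hx, hxE⟩
    rw [← htgt] at hx
    exact ⟨e.symm x, by simpa [e.right_inv hx] using hxE, e.right_inv hx⟩
  · rintro ⟨y, hy, rfl⟩
    refine ⟨?_, hy⟩
    rw [← htgt]
    exact e.map_source (by rw [hsrc]; trivial)

/-- A separation of `J \ E` extends to `J`: a small ball minus `E` is connected and so lies on one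
side, and density of the complement of `E` keeps the two sides disjoint. -/
theorem IsPreconnected.diff_countable {J E : Set ℂ} (hJ : IsPreconnected J) (hJo : IsOpen J)
    (hE : E.Countable) : IsPreconnected (J \ E) := by
  rw [isPreconnected_iff_subset_of_disjoint] at hJ ⊢
  intro u v hu hv huv hdisj
  have hdense : ∀ w : ℂ, ∃ᶠ x in 𝓝 w, x ∉ E := fun w =>
    mem_closure_iff_frequently.mp (hE.dense_compl ℝ w)
  let A : Set ℂ → Set ℂ := fun u => {w | ∀ᶠ x in 𝓝 w, x ∈ J ∧ (x ∉ E → x ∈ u)}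
  have hAo : ∀ u, IsOpen (A u) := fun u => isOpen_setOfPred_eventually_nhds
  have key : J ⊆ A u ∨ J ⊆ A v := by
    refine hJ (A u) (A v) (hAo u) (hAo v) (fun w hw => ?_) ?_
    · obtain ⟨r, hr, hb⟩ := Metric.isOpen_iff.mp hJo w hw
      have h1 := isPreconnected_iff_subset_of_disjoint.mp
        (isPreconnected_ball_diff_countable hE w hr) u v hu hv
        ((sdiff_subset_sdiff_left hb).trans huv)
        (subset_empty_iff.mp (hdisj ▸ inter_subset_inter_left _ (sdiff_subset_sdiff_left hb)))
      rcases h1 with h | h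
      · left
        filter_upwards [Metric.ball_mem_nhds w hr] with x hx using ⟨hb hx, fun hxE => h ⟨hx, hxE⟩⟩
      · right
        filter_upwards [Metric.ball_mem_nhds w hr] with x hx using ⟨hb hx, fun hxE => h ⟨hx, hxE⟩⟩
    · by_contra hne
      obtain ⟨w, hw, hwu, hwv⟩ := Set.nonempty_iff_ne_empty.mpr hne
      obtain ⟨x, hxE, ⟨hxJ, hxu⟩, -, hxv⟩ := ((hdense w).and_eventually (hwu.and hwv)).exists
      have : x ∈ J \ E ∩ (u ∩ v) := ⟨⟨hxJ, hxE⟩, hxu hxE, hxv hxE⟩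
      rw [hdisj] at this
      exact this
  exact key.imp (fun h x hx => (h hx.1).self_of_nhds.2 hx.2)
    (fun h x hx => (h hx.1).self_of_nhds.2 hx.2)

theorem closure_connectedComponentIn_inter_subset {S : Set ℂ} (x : ℂ) :
    closure (connectedComponentIn S x) ∩ S ⊆ connectedComponentIn S x := by
  rintro p ⟨hp, hpS⟩
  by_cases hx : x ∈ S
  · have h1 : IsPreconnected (insert p (connectedComponentIn S x)) :=
      isPreconnected_connectedComponentIn.subset_closure (subset_insert _ _)
        (insert_subset hp subset_closure)
    exact h1.subset_connectedComponentIn (mem_insert_of_mem _ (mem_connectedComponentIn hx))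
      (insert_subset hpS (connectedComponentIn_subset _ _)) (mem_insert _ _)
  · rw [connectedComponentIn_eq_empty hx] at hp
    simp at hp

/-- Components are relatively closed. This is how properness survives passing to a component of a
preimage. -/
theorem IsCompact.connectedComponentIn_inter {S L : Set ℂ} (x : ℂ) (hL : IsCompact L)
    (hLS : L ⊆ S) : IsCompact (connectedComponentIn S x ∩ L) := by
  have : connectedComponentIn S x ∩ L = closure (connectedComponentIn S x) ∩ L :=
    Subset.antisymm (inter_subset_inter_left _ subset_closure) fun p hp =>
      ⟨closure_connectedComponentIn_inter_subset x ⟨hp.1, hLS hp.2⟩, hp.2⟩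
  rw [this]
  exact hL.inter_left isClosed_closure

/-! ### Puzzle pieces and fibers. -/

namespace BoxMap

variable {F : ℂ → ℂ} {U V : Set ℂ}

/-- The puzzle piece of depth `n` around `x`. -/
def piece (F : ℂ → ℂ) (U V : Set ℂ) (n : ℕ) (x : ℂ) : Set ℂ :=
  connectedComponentIn (iterPreimage F U V n) x

theorem IsComplexBoxMapping.isOpen_iterPreimage (hF : IsComplexBoxMapping F U V) (n : ℕ) :
    IsOpen (iterPreimage F U V n) := by
  induction n with
  | zero => exact hF.isOpen_codom
  | succ n ih => exact hF.holomorphic.continuousOn.isOpen_inter_preimage hF.isOpen_dom ih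

theorem IsComplexBoxMapping.iterPreimage_succ_subset (hF : IsComplexBoxMapping F U V) (n : ℕ) :
    iterPreimage F U V (n + 1) ⊆ iterPreimage F U V n := by
  induction n with
  | zero => exact inter_subset_left.trans hF.subset
  | succ n ih => exact inter_subset_inter_right _ (preimage_mono ih)

theorem IsComplexBoxMapping.iterPreimage_antitone (hF : IsComplexBoxMapping F U V) :
    Antitone (iterPreimage F U V) :=
  antitone_nat_of_succ_le hF.iterPreimage_succ_subset

theorem IsComplexBoxMapping.iterPreimage_one (hF : IsComplexBoxMapping F U V) :
    iterPreimage F U V 1 = U :=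
  inter_eq_left.mpr hF.mapsTo

theorem iterate_mem_iterPreimage {n k : ℕ} {x : ℂ} (hx : x ∈ iterPreimage F U V (n + k)) :
    F^[k] x ∈ iterPreimage F U V n := by
  induction k generalizing x with
  | zero => exact hx
  | succ k ih => exact ih hx.2

theorem mem_iterPreimage_add {n k : ℕ} {x : ℂ} (hx : x ∈ iterPreimage F U V k)
    (hk : F^[k] x ∈ iterPreimage F U V n) : x ∈ iterPreimage F U V (n + k) := by
  induction k generalizing x with
  | zero => exact hk
  | succ k ih => exact ⟨hx.1, ih hx.2 hk⟩

theorem IsComplexBoxMapping.differentiableOn_iterate (hF : IsComplexBoxMapping F U V) (k : ℕ) :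
    DifferentiableOn ℂ F^[k] (iterPreimage F U V k) := by
  induction k with
  | zero => exact differentiableOn_id
  | succ k ih =>
    rw [Function.iterate_succ]
    exact ih.comp (hF.holomorphic.mono inter_subset_left) (fun x hx => hx.2)

theorem IsComplexBoxMapping.deriv_iterate_succ (hF : IsComplexBoxMapping F U V) {k : ℕ} {x : ℂ}
    (hx : x ∈ iterPreimage F U V (k + 1)) :
    deriv F^[k + 1] x = deriv F^[k] (F x) * deriv F x := by
  rw [Function.iterate_succ]
  exact deriv_comp x ((hF.differentiableOn_iterate k).differentiableAt
    ((hF.isOpen_iterPreimage k).mem_nhds hx.2))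
    (hF.holomorphic.differentiableAt (hF.isOpen_dom.mem_nhds hx.1))

theorem IsComplexBoxMapping.deriv_iterate_ne_zero (hF : IsComplexBoxMapping F U V) {k : ℕ} {x : ℂ}
    (hx : x ∈ iterPreimage F U V k) (hcrit : ∀ i < k, F^[i] x ∉ critPoints F U) :
    deriv F^[k] x ≠ 0 := by
  induction k generalizing x with
  | zero => simp
  | succ k ih =>
    rw [hF.deriv_iterate_succ hx]
    refine mul_ne_zero (ih hx.2 fun i hi => ?_) fun h0 => hcrit 0 (by omega) ⟨hx.1, h0⟩
    exact hcrit (i + 1) (by omega)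

theorem mem_piece {n : ℕ} {x : ℂ} (hx : x ∈ iterPreimage F U V n) : x ∈ piece F U V n x :=
  mem_connectedComponentIn hx

theorem piece_subset (n : ℕ) (x : ℂ) : piece F U V n x ⊆ iterPreimage F U V n :=
  connectedComponentIn_subset _ _

theorem IsComplexBoxMapping.isOpen_piece (hF : IsComplexBoxMapping F U V) (n : ℕ) (x : ℂ) :
    IsOpen (piece F U V n x) :=
  (hF.isOpen_iterPreimage n).connectedComponentIn

theorem isPreconnected_piece (n : ℕ) (x : ℂ) : IsPreconnected (piece F U V n x) :=
  isPreconnected_connectedComponentIn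

theorem piece_eq {n : ℕ} {x y : ℂ} (h : y ∈ piece F U V n x) :
    piece F U V n y = piece F U V n x :=
  (connectedComponentIn_eq h).symm

theorem IsComplexBoxMapping.piece_antitone (hF : IsComplexBoxMapping F U V) (x : ℂ) :
    Antitone fun n => piece F U V n x :=
  fun _ _ h => connectedComponentIn_mono x (hF.iterPreimage_antitone h)

theorem isPuzzlePiece_piece {n : ℕ} {x : ℂ} (hx : x ∈ iterPreimage F U V n) :
    IsPuzzlePiece F U V (piece F U V n x) :=
  ⟨n, x, hx, rfl⟩

theorem IsComplexBoxMapping.mapsTo_piece (hF : IsComplexBoxMapping F U V) {n k : ℕ} {x : ℂ}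
    (hx : x ∈ iterPreimage F U V (n + k)) :
    MapsTo F^[k] (piece F U V (n + k) x) (piece F U V n (F^[k] x)) := by
  have h1 : IsPreconnected (F^[k] '' piece F U V (n + k) x) :=
    (isPreconnected_piece _ _).image _ ((hF.differentiableOn_iterate k).continuousOn.mono
      ((piece_subset _ _).trans (hF.iterPreimage_antitone (by omega))))
  have h2 := h1.subset_connectedComponentIn (F := iterPreimage F U V n)
    (mem_image_of_mem _ (mem_piece hx))
    (by
      rintro _ ⟨y, hy, rfl⟩
      exact iterate_mem_iterPreimage (piece_subset _ _ hy))
  exact fun y hy => h2 (mem_image_of_mem _ hy)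

/-- Properness passes from components of `U` to puzzle pieces: the compact preimage in the component
of `U` lies in the next iterated preimage, where the piece is relatively closed. -/
theorem IsComplexBoxMapping.isCompact_piece_succ_inter (hF : IsComplexBoxMapping F U V) {n : ℕ}
    {x : ℂ} (hx : x ∈ iterPreimage F U V (n + 1)) {K : Set ℂ} (hK : K ⊆ piece F U V n (F x))
    (hKc : IsCompact K) : IsCompact (piece F U V (n + 1) x ∩ F ⁻¹' K) := by
  set C := connectedComponentIn U x with hC
  have hxC : x ∈ C := mem_connectedComponentIn hx.1
  have hFC : piece F U V n (F x) ⊆ F '' C := by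
    obtain ⟨v, hv, hvC⟩ := hF.image_component C ⟨x, hx.1, rfl⟩
    have h1 : F x ∈ connectedComponentIn V v := by
      rw [← hvC]
      exact mem_image_of_mem _ hxC
    rw [hvC, connectedComponentIn_eq h1]
    exact connectedComponentIn_mono _ (hF.iterPreimage_antitone (Nat.zero_le n))
  have hL := hF.proper C ⟨x, hx.1, rfl⟩ K (hK.trans hFC) hKc
  have hLS : C ∩ F ⁻¹' K ⊆ iterPreimage F U V (n + 1) := fun y hy =>
    ⟨connectedComponentIn_subset _ _ hy.1, piece_subset _ _ (hK hy.2)⟩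
  have h2 := hL.connectedComponentIn_inter x hLS
  convert h2 using 1
  refine Subset.antisymm (fun y hy => ⟨hy.1, ?_, hy.2⟩) (fun y hy => ⟨hy.1, hy.2.2⟩)
  exact connectedComponentIn_mono x (inter_subset_left) hy.1

theorem IsComplexBoxMapping.isCompact_piece_inter (hF : IsComplexBoxMapping F U V) {n k : ℕ}
    {x : ℂ} (hx : x ∈ iterPreimage F U V (n + k)) {K : Set ℂ}
    (hK : K ⊆ piece F U V n (F^[k] x)) (hKc : IsCompact K) :
    IsCompact (piece F U V (n + k) x ∩ F^[k] ⁻¹' K) := by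
  induction k generalizing x with
  | zero =>
    have : piece F U V (n + 0) x ∩ F^[0] ⁻¹' K = K := inter_eq_right.mpr hK
    rwa [this]
  | succ k ih =>
    have h1 := ih (x := F x) hx.2 hK
    have h2 := hF.isCompact_piece_succ_inter (n := n + k) hx inter_subset_left h1
    convert h2 using 1
    refine Subset.antisymm (fun y hy => ⟨hy.1, ?_, hy.2⟩) (fun y hy => ⟨hy.1, hy.2.2⟩)
    exact hF.mapsTo_piece (k := 1) (n := n + k) hx hy.1

theorem IsComplexBoxMapping.isBounded_codom (hF : IsComplexBoxMapping F U V) :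
    Bornology.IsBounded V := by
  have h : V ⊆ ⋃₀ {W : Set ℂ | IsComponent W V} := fun x hx =>
    ⟨connectedComponentIn V x, ⟨x, hx, rfl⟩, mem_connectedComponentIn hx⟩
  exact ((Bornology.isBounded_sUnion hF.finite_components).mpr
    fun W hW => isBounded_of_isJordanDisk (hF.jordan_codom W hW)).subset h

theorem IsComplexBoxMapping.piece_subset_codom (hF : IsComplexBoxMapping F U V) (n : ℕ) (x : ℂ) :
    piece F U V n x ⊆ V :=
  (piece_subset n x).trans (hF.iterPreimage_antitone (Nat.zero_le n))

theorem IsComplexBoxMapping.isBounded_piece (hF : IsComplexBoxMapping F U V) (n : ℕ) (x : ℂ) :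
    Bornology.IsBounded (piece F U V n x) :=
  hF.isBounded_codom.subset (hF.piece_subset_codom n x)

theorem mem_iterPreimage_of_mem_filledJulia {x : ℂ} (hx : x ∈ filledJulia F U V) (n : ℕ) :
    x ∈ iterPreimage F U V n :=
  mem_iInter.mp hx n

theorem iterate_mem_filledJulia {x : ℂ} (hx : x ∈ filledJulia F U V) (k : ℕ) :
    F^[k] x ∈ filledJulia F U V :=
  mem_iInter.mpr fun n => iterate_mem_iterPreimage (mem_iInter.mp hx (n + k))

theorem IsComplexBoxMapping.piece_one_eq_or (hF : IsComplexBoxMapping F U V) {x : ℂ}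
    (hx : x ∈ U) :
    piece F U V 1 x = piece F U V 0 x ∨ closure (piece F U V 1 x) ⊆ piece F U V 0 x := by
  have h1 : piece F U V 1 x = connectedComponentIn U x := by
    rw [piece, hF.iterPreimage_one]
  have h0 : piece F U V 0 x = connectedComponentIn V x := rfl
  rcases hF.components (connectedComponentIn V x) ⟨x, hF.subset hx, rfl⟩ with h | h
  · left
    obtain ⟨u, hu, he⟩ := h
    have hxu : x ∈ connectedComponentIn U u := by
      rw [← he]
      exact mem_connectedComponentIn (hF.subset hx)
    rw [h0, h1, he, connectedComponentIn_eq hxu]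
  · right
    rw [h0, h1]
    exact (h.1 _ ⟨x, hx, rfl⟩ (connectedComponentIn_mono x hF.subset)).2

/-- Without permuted components, puzzle pieces around a non-escaping point are compactly nested. -/
theorem IsComplexBoxMapping.exists_closure_piece_subset (hF : IsComplexBoxMapping F U V)
    (hperm : NoPermutation F U) {x : ℂ} (hx : x ∈ filledJulia F U V) (n₀ : ℕ) :
    ∃ n ≥ n₀, closure (piece F U V (n + 1) x) ⊆ piece F U V n x := by
  have hmem := fun k n => mem_iterPreimage_of_mem_filledJulia (iterate_mem_filledJulia hx k) n
  have hdom : ∀ k, F^[k] x ∈ U := fun k => by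
    rw [← hF.iterPreimage_one]
    exact hmem k 1
  -- Compact nesting of depths `1` and `0` at some point of the orbit pulls back by a proper
  -- iterate. If it fails at all late times, the components of `U` met there are full components of
  -- `V`, and the first of them never leaves `U`.
  by_cases hex : ∃ n ≥ n₀, closure (piece F U V 1 (F^[n] x)) ⊆ piece F U V 0 (F^[n] x)
  · obtain ⟨n, hn, hcl⟩ := hex
    refine ⟨n, hn, ?_⟩
    have hxn : x ∈ iterPreimage F U V (0 + n) := mem_iterPreimage_of_mem_filledJulia hx _
    have hcpt := hF.isCompact_piece_inter (n := 0) (k := n) hxn hcl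
      (hF.isBounded_piece 1 _).isCompact_closure
    have hsub : piece F U V (n + 1) x ⊆ piece F U V (0 + n) x ∩
        F^[n] ⁻¹' closure (piece F U V 1 (F^[n] x)) := fun y hy => by
      refine ⟨hF.piece_antitone x (by omega) hy, subset_closure ?_⟩
      have := hF.mapsTo_piece (n := 1) (k := n) (x := x)
        (mem_iterPreimage_of_mem_filledJulia hx _)
      rw [add_comm] at this
      exact this hy
    have h2 := closure_minimal hsub hcpt.isClosed
    rw [zero_add] at h2
    exact h2.trans inter_subset_left
  · exfalso
    push Not at hex
    have heq : ∀ n ≥ n₀, piece F U V 1 (F^[n] x) = piece F U V 0 (F^[n] x) := fun n hn =>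
      (hF.piece_one_eq_or (hdom n)).resolve_right (hex n hn)
    have hcomp : piece F U V 1 (F^[n₀] x) = connectedComponentIn U (F^[n₀] x) := by
      rw [piece, hF.iterPreimage_one]
    obtain ⟨m, z, hz, hmz⟩ := hperm (piece F U V 1 (F^[n₀] x)) ⟨_, hdom n₀, hcomp⟩
    have hall : ∀ m, F^[m] z ∈ piece F U V 1 (F^[m + n₀] x) := by
      intro m
      induction m with
      | zero => simpa using hz
      | succ m ih =>
        have h3 := hF.mapsTo_piece (n := 0) (k := 1) (hmem (m + n₀) 1) ih
        rw [Function.iterate_succ_apply', heq _ (by omega),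
          show m + 1 + n₀ = (m + n₀) + 1 by ring, Function.iterate_succ_apply']
        exact h3
    exact hmz (by rw [← hF.iterPreimage_one]; exact piece_subset _ _ (hall m))

theorem fiber_eq {x : ℂ}
    (hx : x ∈ filledJulia F U V) : fiber F U V x = ⋂ n, piece F U V n x := by
  refine Subset.antisymm (fun y hy => mem_iInter.mpr fun n => ?_) (fun y hy => ?_)
  · have hxn := mem_iterPreimage_of_mem_filledJulia hx n
    exact hy _ ⟨isPuzzlePiece_piece hxn, mem_piece hxn⟩
  · rintro P ⟨⟨n, u, hu, rfl⟩, hxP⟩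
    have := mem_iInter.mp hy n
    rw [piece, ← connectedComponentIn_eq hxP] at this
    exact this

theorem mem_fiber_iff {x y : ℂ}
    (hx : x ∈ filledJulia F U V) : y ∈ fiber F U V x ↔ ∀ n, y ∈ piece F U V n x := by
  rw [fiber_eq hx, mem_iInter]

theorem mem_fiber_self (x : ℂ) : x ∈ fiber F U V x := fun _ hP => hP.2

theorem mem_filledJulia_of_mem_fiber {x y : ℂ}
    (hx : x ∈ filledJulia F U V) (hy : y ∈ fiber F U V x) : y ∈ filledJulia F U V :=
  mem_iInter.mpr fun n => piece_subset n x ((mem_fiber_iff hx).mp hy n)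

theorem fiber_eq_of_mem {x y : ℂ}
    (hx : x ∈ filledJulia F U V) (hy : y ∈ fiber F U V x) : fiber F U V y = fiber F U V x := by
  rw [fiber_eq hx, fiber_eq (mem_filledJulia_of_mem_fiber hx hy)]
  exact iInter_congr fun n => piece_eq ((mem_fiber_iff hx).mp hy n)

theorem IsComplexBoxMapping.mapsTo_fiber (hF : IsComplexBoxMapping F U V) {x : ℂ}
    (hx : x ∈ filledJulia F U V) (k : ℕ) :
    MapsTo F^[k] (fiber F U V x) (fiber F U V (F^[k] x)) := by
  intro y hy
  rw [mem_fiber_iff (iterate_mem_filledJulia hx k)]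
  exact fun n => hF.mapsTo_piece (mem_iterPreimage_of_mem_filledJulia hx _)
    ((mem_fiber_iff hx).mp hy (n + k))

/-- Compact nesting at arbitrarily large depths absorbs the closures, which makes fibers compact. -/
theorem IsComplexBoxMapping.fiber_eq_iInter_closure (hF : IsComplexBoxMapping F U V)
    (hperm : NoPermutation F U) {x : ℂ} (hx : x ∈ filledJulia F U V) :
    fiber F U V x = ⋂ n, closure (piece F U V n x) := by
  rw [fiber_eq hx]
  refine Subset.antisymm (iInter_mono fun n => subset_closure) (fun y hy => mem_iInter.mpr ?_)
  intro n
  obtain ⟨m, hm, hcl⟩ := hF.exists_closure_piece_subset hperm hx n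
  exact hF.piece_antitone x hm (hcl (mem_iInter.mp hy (m + 1)))

theorem IsComplexBoxMapping.isCompact_fiber (hF : IsComplexBoxMapping F U V)
    (hperm : NoPermutation F U) {x : ℂ} (hx : x ∈ filledJulia F U V) :
    IsCompact (fiber F U V x) := by
  rw [hF.fiber_eq_iInter_closure hperm hx]
  exact (hF.isBounded_piece 0 x).isCompact_closure.of_isClosed_subset
    (isClosed_iInter fun n => isClosed_closure) (iInter_subset _ 0)

theorem IsComplexBoxMapping.exists_piece_subset (hF : IsComplexBoxMapping F U V)
    (hperm : NoPermutation F U) {x : ℂ} (hx : x ∈ filledJulia F U V) {O : Set ℂ} (hO : IsOpen O)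
    (hfO : fiber F U V x ⊆ O) : ∃ n, piece F U V n x ⊆ O := by
  obtain ⟨n, hn⟩ := exists_subset_nhds_of_isCompact (V := fun n => closure (piece F U V n x))
    (Antitone.directed_ge fun m n h => closure_mono (hF.piece_antitone x h))
    (fun n => (hF.isBounded_piece n x).isCompact_closure)
    (U := O) (fun y hy => hO.mem_nhds (hfO (by rwa [hF.fiber_eq_iInter_closure hperm hx])))
  exact ⟨n, subset_closure.trans hn⟩

end BoxMap

/-! ### Density points and orbits avoiding critical fibers. -/

/-- Almost every point of `X` is a density point. The subset `Y` may be non-measurable: positive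
outer measure suffices to find such a point in it. -/
theorem exists_tendsto_measure_closedBall_diff {X Y : Set ℂ} (hX : NullMeasurableSet X volume)
    (hYX : Y ⊆ X) (hY : volume Y ≠ 0) :
    ∃ z ∈ Y, Tendsto (fun r => volume (Metric.closedBall z r \ X) / volume (Metric.closedBall z r))
      (𝓝[>] 0) (𝓝 0) := by
  have h1 := (ae_restrict_iff'₀ hX).mp (Besicovitch.ae_tendsto_measure_inter_div volume X)
  obtain ⟨z, hzY, hz⟩ : ∃ z ∈ Y, z ∈ X →
      Tendsto (fun r => volume (X ∩ Metric.closedBall z r) / volume (Metric.closedBall z r))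
        (𝓝[>] 0) (𝓝 1) := by
    by_contra hcon
    push Not at hcon
    refine hY (measure_mono_null (fun z hz => ?_) (ae_iff.mp h1))
    have := hcon z hz
    simp only [mem_ofPred_eq, Classical.not_imp]
    exact this
  refine ⟨z, hzY, ?_⟩
  have h2 := ENNReal.Tendsto.sub (f := 𝓝[>] (0 : ℝ)) (tendsto_const_nhds (x := (1 : ℝ≥0∞)))
    (hz (hYX hzY)) (Or.inl ENNReal.one_ne_top)
  rw [tsub_self] at h2
  refine h2.congr' ?_
  filter_upwards [self_mem_nhdsWithin] with r hr
  have hpos : volume (Metric.closedBall z r) ≠ 0 := (Metric.measure_closedBall_pos _ _ hr).ne'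
  have hfin : volume (Metric.closedBall z r) ≠ ∞ := measure_closedBall_lt_top.ne
  have h3 := measure_inter_add_sdiff₀ (Metric.closedBall z r) hX
  rw [add_comm] at h3
  have h4 := ENNReal.eq_sub_of_add_eq' hfin h3
  rw [h4, ENNReal.sub_div (fun _ _ => hpos), ENNReal.div_self hpos hfin, inter_comm]

namespace BoxMap

variable {F : ℂ → ℂ} {U V : Set ℂ}

theorem mapsTo_ergodicSet :
    MapsTo F (ergodicSet F U V) (ergodicSet F U V) := by
  rintro z ⟨hzK, hz⟩
  refine ⟨iterate_mem_filledJulia hzK 1, fun h => hz ?_⟩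
  rcases h with ⟨-, h⟩ | ⟨-, i, hi, h⟩
  · exact Or.inl ⟨hzK, (tendsto_add_atTop_iff_nat 1).mp h⟩
  · exact Or.inr ⟨hzK, fun j => i j + 1, tendsto_atTop_mono (fun j => Nat.le_succ _) hi, h⟩

theorem mem_recurrentPoints_of_tendsto {z : ℂ} (hz : z ∈ filledJulia F U V) {A : Set ℂ}
    (hA : IsRecurrentCriticalFiber F U V A) {i : ℕ → ℕ} (hi : Tendsto i atTop atTop)
    (hconv : ConvergesToSet (fun j => F^[i j] z) A) : z ∈ recurrentPoints F U V := by
  refine ⟨hz, i, hi, ?_⟩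
  exact tendsto_of_tendsto_of_tendsto_of_le_of_le tendsto_const_nhds hconv (fun j => zero_le)
    (fun j => Metric.infEDist_anti (subset_sUnion_of_mem hA))

/-- One returning point brings the whole fiber back: the image lies in a single fiber, and fibers
that meet coincide. -/
theorem IsComplexBoxMapping.iterate_mul_mem_fiber (hF : IsComplexBoxMapping F U V) {c x : ℂ}
    (hc : c ∈ filledJulia F U V) {l : ℕ} (hx : x ∈ fiber F U V c)
    (hlx : F^[l] x ∈ fiber F U V c) (m : ℕ) :
    MapsTo F^[m * l] (fiber F U V c) (fiber F U V c) := by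
  have h1 : MapsTo F^[l] (fiber F U V c) (fiber F U V c) := by
    have h2 := hF.mapsTo_fiber hc l
    rwa [← fiber_eq_of_mem (iterate_mem_filledJulia hc l) (h2 hx),
      fiber_eq_of_mem hc hlx] at h2
  rw [mul_comm, Function.iterate_mul]
  exact h1.iterate m

theorem IsComplexBoxMapping.isRecurrentCriticalFiber_of_iterate_mem
    (hF : IsComplexBoxMapping F U V) (hperm : NoPermutation F U) {c x : ℂ}
    (hcc : c ∈ critPoints F U) (hc : c ∈ filledJulia F U V) {l : ℕ} (hl : 0 < l)
    (hx : x ∈ fiber F U V c) (hlx : F^[l] x ∈ fiber F U V c) :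
    IsRecurrentCriticalFiber F U V (fiber F U V c) := by
  refine ⟨⟨c, hcc, hc, rfl⟩, fun m => m * l, tendsto_id.atTop_mul_const' hl, fun _ => c,
    fun _ => mem_fiber_self c, ?_⟩
  exact (hF.isCompact_fiber hperm hc).exists_mapClusterPt_of_frequently
    (Frequently.of_forall fun m => hF.iterate_mul_mem_fiber hc hx hlx m (mem_fiber_self c))

/-- Two visits make the fiber periodic, hence recurrent, and the orbit then visits it infinitely
often, which is excluded on the ergodic set. -/
theorem IsComplexBoxMapping.not_iterate_mem_fiber (hF : IsComplexBoxMapping F U V)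
    (hperm : NoPermutation F U) {z c : ℂ} (hz : z ∈ ergodicSet F U V)
    (hcc : c ∈ critPoints F U) (hc : c ∈ filledJulia F U V) {i j : ℕ} (hij : i < j)
    (hi : F^[i] z ∈ fiber F U V c) : F^[j] z ∉ fiber F U V c := by
  intro hj
  have hl : F^[j - i] (F^[i] z) ∈ fiber F U V c := by
    rwa [← Function.iterate_add_apply, Nat.sub_add_cancel hij.le]
  have hrec := hF.isRecurrentCriticalFiber_of_iterate_mem hperm hcc hc (by omega) hi hl
  refine hz.2 (Or.inr (mem_recurrentPoints_of_tendsto hz.1 hrec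
    (i := fun m => m * (j - i) + i) (tendsto_atTop_mono (fun m => Nat.le_add_right _ i)
      (tendsto_id.atTop_mul_const' (Nat.sub_pos_of_lt hij))) ?_))
  refine tendsto_const_nhds.congr fun m => ?_
  simp only
  rw [Function.iterate_add_apply]
  exact (Metric.infEDist_zero_of_mem (hF.iterate_mul_mem_fiber hc hi hl m hi)).symm

/-- The orbit of `z` never meets the fiber of a non-escaping critical point. -/
def AvoidsCriticalFibers (F : ℂ → ℂ) (U V : Set ℂ) (z : ℂ) : Prop :=
  ∀ c ∈ critPoints F U, c ∈ filledJulia F U V → ∀ i : ℕ, F^[i] z ∉ fiber F U V c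

theorem IsComplexBoxMapping.exists_iterate_avoidsCriticalFibers (hF : IsComplexBoxMapping F U V)
    (hperm : NoPermutation F U) {z : ℂ} (hz : z ∈ ergodicSet F U V) :
    ∃ N, AvoidsCriticalFibers F U V (F^[N] z) := by
  have h1 : ∀ c ∈ critPoints F U, ∀ᶠ N in atTop, c ∈ filledJulia F U V →
      F^[N] z ∉ fiber F U V c := by
    intro c hcc
    by_cases hc : c ∈ filledJulia F U V
    · by_cases hex : ∃ i, F^[i] z ∈ fiber F U V c
      · obtain ⟨i, hi⟩ := hex
        filter_upwards [eventually_gt_atTop i] with j hj _ using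
          hF.not_iterate_mem_fiber hperm hz hcc hc hj hi
      · push Not at hex
        exact Eventually.of_forall fun j _ => hex j
    · exact Eventually.of_forall fun j h => absurd h hc
  obtain ⟨N, hN⟩ := eventually_atTop.mp ((eventually_all_finite hF.finite_crit).mpr h1)
  refine ⟨N, fun c hcc hc i => ?_⟩
  rw [← Function.iterate_add_apply]
  exact hN _ (by omega) c hcc hc

/-- Away from the finitely many critical points, local holomorphic inverses carry null sets to null
sets. -/
theorem IsComplexBoxMapping.volume_preimage_eq_zero (hF : IsComplexBoxMapping F U V) {E : Set ℂ}
    (hE : volume E = 0) : volume (U ∩ F ⁻¹' E) = 0 := by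
  have hcrit : volume (critPoints F U) = 0 := hF.finite_crit.measure_zero _
  refine measure_mono_null (t := critPoints F U ∪ (U ∩ F ⁻¹' E) \ critPoints F U)
    (fun x hx => ?_) (measure_union_null hcrit (measure_null_of_locally_null _ fun x hx => ?_))
  · by_cases h : x ∈ critPoints F U
    · exact Or.inl h
    · exact Or.inr ⟨hx, h⟩
  · have hd : ∀ y ∈ (U ∩ F ⁻¹' E) \ critPoints F U, deriv F y ≠ 0 := fun y hy h0 =>
      hy.2 ⟨hy.1.1, h0⟩
    have hs : HasStrictDerivAt F (deriv F x) x :=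
      (hF.holomorphic.analyticAt (hF.isOpen_dom.mem_nhds hx.1.1)).hasStrictDerivAt
    set e := (hs.hasStrictFDerivAt_equiv (hd x hx)).toOpenPartialHomeomorph F with he
    have hxe : x ∈ e.source :=
      (hs.hasStrictFDerivAt_equiv (hd x hx)).mem_toOpenPartialHomeomorph_source
    have heF : ∀ y, e y = F y := fun y => rfl
    refine ⟨e.source ∩ ((U ∩ F ⁻¹' E) \ critPoints F U),
      inter_mem (mem_nhdsWithin_of_mem_nhds (e.open_source.mem_nhds hxe))
        self_mem_nhdsWithin, ?_⟩
    have himg : e.source ∩ ((U ∩ F ⁻¹' E) \ critPoints F U) =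
        e.symm '' (e '' (e.source ∩ ((U ∩ F ⁻¹' E) \ critPoints F U))) := by
      rw [← image_comp]
      ext y
      constructor
      · exact fun hy => ⟨y, hy, e.left_inv hy.1⟩
      · rintro ⟨y, hy, rfl⟩
        rw [Function.comp_apply, e.left_inv hy.1]
        exact hy
    rw [himg]
    refine addHaar_image_eq_zero_of_differentiableOn_of_addHaar_eq_zero volume ?_ ?_
    · rintro _ ⟨y, hy, rfl⟩
      have hdy : HasDerivAt e (deriv F y) (e.symm (e y)) := by
        rw [e.left_inv hy.1]
        exact (hF.holomorphic.differentiableAt (hF.isOpen_dom.mem_nhds hy.2.1.1)).hasDerivAt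
      exact ((e.hasDerivAt_symm (e.map_source hy.1) (hd y hy.2)
        hdy).differentiableAt.restrictScalars ℝ).differentiableWithinAt
    · refine measure_mono_null ?_ hE
      rintro _ ⟨y, hy, rfl⟩
      exact hy.2.1.2

theorem IsComplexBoxMapping.volume_iterPreimage_inter_eq_zero (hF : IsComplexBoxMapping F U V)
    {E : Set ℂ} (hE : volume E = 0) (k : ℕ) :
    volume (iterPreimage F U V k ∩ F^[k] ⁻¹' E) = 0 := by
  induction k with
  | zero => exact measure_mono_null inter_subset_right hE
  | succ k ih =>
    refine measure_mono_null ?_ (hF.volume_preimage_eq_zero ih)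
    exact fun x hx => ⟨hx.1.1, hx.1.2, hx.2⟩

theorem IsComplexBoxMapping.volume_avoidsCriticalFibers_ne_zero (hF : IsComplexBoxMapping F U V)
    (hperm : NoPermutation F U) {X : Set ℂ} (hX : X ⊆ ergodicSet F U V) (hFX : MapsTo F X X)
    (hpos : volume X ≠ 0) : volume {z ∈ X | AvoidsCriticalFibers F U V z} ≠ 0 := by
  intro h0
  refine hpos (measure_mono_null (fun z hz => ?_)
    (measure_iUnion_null fun k => hF.volume_iterPreimage_inter_eq_zero h0 k))
  obtain ⟨N, hN⟩ := hF.exists_iterate_avoidsCriticalFibers hperm (hX hz)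
  exact mem_iUnion.mpr ⟨N, mem_iterPreimage_of_mem_filledJulia (hX hz).1 N,
    hFX.iterate N hz, hN⟩

end BoxMap

/-! ### Contraction of inverse branches. -/

/-- `φ` is a holomorphic right inverse of `G` on the disk `ball w r` with values in `A`. -/
structure IsInverseBranch (G φ : ℂ → ℂ) (A : Set ℂ) (w : ℂ) (r : ℝ) : Prop where
  differentiableOn : DifferentiableOn ℂ φ (Metric.ball w r)
  mapsTo : MapsTo φ (Metric.ball w r) A
  rightInv : ∀ v ∈ Metric.ball w r, G (φ v) = v

theorem nonempty_compl_of_isBounded {S : Set ℂ} (hS : Bornology.IsBounded S) : Sᶜ.Nonempty := by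
  by_contra h
  rw [not_nonempty_iff_eq_empty, compl_empty_iff] at h
  rw [h] at hS
  exact NormedSpace.unbounded_univ ℝ ℂ hS

namespace BoxMap

variable {F : ℂ → ℂ} {U V : Set ℂ}

/-- An elementary substitute for hyperbolic expansion. A disk in a deep piece lifts through the
unbranched return map into a piece compactly contained in it, which leaves room to enlarge the lift
about its center by a fixed factor `1 + t`. Repeating this `m` times gives the power. -/
theorem IsComplexBoxMapping.exists_disk_with_large_deriv (hF : IsComplexBoxMapping F U V)
    (hperm : NoPermutation F U) {y : ℂ} (hy : y ∈ filledJulia F U V) {l : ℕ}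
    (hly : F^[l] y ∈ fiber F U V y) (hl : 0 < l)
    (hcrit : ∀ i < l, ∀ c ∈ critPoints F U, c ∉ fiber F U V (F^[i] y)) :
    ∃ n : ℕ, ∃ δ > 0, ∃ t > 0, ∀ m : ℕ, ∀ x ∈ fiber F U V y, ∃ f : ℂ → ℂ,
      DifferentiableOn ℂ f (Metric.ball 0 δ) ∧ MapsTo f (Metric.ball 0 δ) (piece F U V n y) ∧
        f 0 = x ∧ deriv f 0 * deriv ((F^[l])^[m]) x = ((1 + t : ℝ) : ℂ) ^ m := by
  have hmem := fun k n => mem_iterPreimage_of_mem_filledJulia (iterate_mem_filledJulia hy k) n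
  have hev : ∀ᶠ n in atTop, ∀ i < l, ∀ c ∈ critPoints F U, c ∉ piece F U V n (F^[i] y) := by
    refine (eventually_all_finite (finite_lt_nat l)).mpr fun i hi =>
      (eventually_all_finite hF.finite_crit).mpr fun c hc => ?_
    have h1 := hcrit i hi c hc
    rw [mem_fiber_iff (iterate_mem_filledJulia hy i)] at h1
    push Not at h1
    obtain ⟨n, hn⟩ := h1
    filter_upwards [eventually_ge_atTop n] with m hm h2 using hn (hF.piece_antitone _ hm h2)
  obtain ⟨n₁, hn₁⟩ := eventually_atTop.mp hev
  obtain ⟨n, hn, hcl⟩ := hF.exists_closure_piece_subset hperm hy n₁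
  have hcpt : IsCompact (closure (piece F U V (n + 1) y)) :=
    (hF.isBounded_piece _ _).isCompact_closure
  obtain ⟨δ, hδ, hthick⟩ := hcpt.exists_thickening_subset_open (hF.isOpen_piece n y) hcl
  obtain ⟨M, hM0, hM⟩ : ∃ M > 0, ∀ a ∈ V, ∀ b ∈ V, ‖a - b‖ ≤ M := by
    obtain ⟨M, hM⟩ := Metric.isBounded_iff.mp hF.isBounded_codom
    exact ⟨max M 1, by positivity, fun a ha b hb => by
      rw [← dist_eq_norm]
      exact (hM ha hb).trans (le_max_left _ _)⟩
  have hfib : fiber F U V y ⊆ piece F U V (n + 1) y := fun x hx =>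
    (mem_fiber_iff hy).mp hx _
  have hnear : ∀ x ∈ piece F U V (n + 1) y, ∀ v, ‖v‖ < δ → x + v ∈ piece F U V n y := by
    intro x hx v hv
    refine hthick (Metric.mem_thickening_iff.mpr ⟨x, subset_closure hx, ?_⟩)
    simpa [dist_eq_norm] using hv
  -- the return map is proper and has no critical points
  have hpy : piece F U V n (F^[l] y) = piece F U V n y :=
    piece_eq ((mem_fiber_iff hy).mp hly n)
  have hA := hmem 0 (n + l)
  have hmaps := hF.mapsTo_piece (n := n) (k := l) hA
  simp only [Function.iterate_zero, id] at hA hmaps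
  have hproper := fun K => hF.isCompact_piece_inter (n := n) (k := l) hA (K := K)
  rw [hpy] at hmaps hproper
  have hderiv : ∀ x ∈ piece F U V (n + l) y, deriv F^[l] x ≠ 0 := by
    intro x hx
    refine hF.deriv_iterate_ne_zero
      (hF.iterPreimage_antitone (by omega) (piece_subset _ _ hx)) fun i hi hc => ?_
    refine hn₁ (n + l - i) (by omega) i hi _ hc ?_
    have e : n + l = (n + l - i) + i := by omega
    have h2 := hF.mapsTo_piece (n := n + l - i) (k := i) (x := y) (by rw [← e]; exact hA)
    rw [← e] at h2
    exact h2 hx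
  have hdiff : DifferentiableOn ℂ F^[l] (piece F U V (n + l) y) :=
    (hF.differentiableOn_iterate l).mono
      ((piece_subset _ _).trans (hF.iterPreimage_antitone (by omega)))
  have hfibmaps : MapsTo F^[l] (fiber F U V y) (fiber F U V y) := by
    simpa using hF.iterate_mul_mem_fiber hy (mem_fiber_self y) hly 1
  refine ⟨n, δ, hδ, δ / (2 * M), by positivity, fun m => ?_⟩
  induction m with
  | zero =>
    intro x hx
    refine ⟨fun w => x + w, by fun_prop, fun w hw => hnear x (hfib hx) w (by simpa using hw),
      by simp, ?_⟩
    simp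
  | succ m ih =>
    intro x hx
    obtain ⟨f, hf, hfm, hf0, hfd⟩ := ih (F^[l] x) (hfibmaps hx)
    have hxA : x ∈ piece F U V (n + l) y := (mem_fiber_iff hy).mp hx _
    obtain ⟨h, hh, hhm, hfh, hh0⟩ := exists_holomorphic_lift (hF.isOpen_piece (n + l) y)
      (hF.isOpen_piece n y) hdiff hmaps hderiv hproper hδ hf hfm hxA hf0.symm
    have h0mem : (0 : ℂ) ∈ Metric.ball (0 : ℂ) δ := Metric.mem_ball_self hδ
    have hhd : DifferentiableAt ℂ h 0 := hh.differentiableAt (Metric.ball_mem_nhds _ hδ)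
    -- Since `‖h w - x‖ ≤ M`, the added term has norm at most `δ / 2`, within the `δ`-neighbourhood
    -- contained in the larger piece.
    refine ⟨fun w => h w + ((δ / (2 * M) : ℝ) : ℂ) * (h w - x), ?_, fun w hw => ?_, ?_, ?_⟩
    · exact hh.add ((hh.sub_const x).const_mul _)
    · refine hnear _ (hF.piece_antitone y (by omega : n + 1 ≤ n + l) (hhm hw)) _ ?_
      have h1 : ‖h w - x‖ ≤ M := hM _ (hF.piece_subset_codom _ _ (hhm hw)) _
        (hF.piece_subset_codom _ _ hxA)
      rw [norm_mul, Complex.norm_real, Real.norm_of_nonneg (by positivity)]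
      calc δ / (2 * M) * ‖h w - x‖ ≤ δ / (2 * M) * M := by gcongr
        _ = δ / 2 := by field_simp
        _ < δ := by linarith
    · simp [hh0]
    · have h1 : HasDerivAt (fun w => h w + ((δ / (2 * M) : ℝ) : ℂ) * (h w - x))
          (deriv h 0 + ((δ / (2 * M) : ℝ) : ℂ) * deriv h 0) 0 :=
        hhd.hasDerivAt.add ((hhd.hasDerivAt.sub_const x).const_mul _)
      have hGx : DifferentiableAt ℂ F^[l] x :=
        hdiff.differentiableAt ((hF.isOpen_piece _ _).mem_nhds hxA)
      have h2 : deriv f 0 = deriv F^[l] x * deriv h 0 := by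
        have h3 : HasDerivAt (F^[l] ∘ h) (deriv F^[l] x * deriv h 0) 0 := by
          refine HasDerivAt.comp 0 ?_ hhd.hasDerivAt
          rw [hh0]
          exact hGx.hasDerivAt
        refine (h3.congr_of_eventuallyEq ?_).deriv
        filter_upwards [Metric.ball_mem_nhds (0 : ℂ) hδ] with w hw using (hfh w hw).symm
      have h4 : deriv ((F^[l])^[m + 1]) x = deriv ((F^[l])^[m]) (F^[l] x) * deriv F^[l] x := by
        rw [Function.iterate_succ]
        refine deriv_comp x ?_ hGx
        rw [← Function.iterate_mul]
        refine (hF.differentiableOn_iterate (l * m)).differentiableAt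
          ((hF.isOpen_iterPreimage _).mem_nhds ?_)
        exact mem_iterPreimage_of_mem_filledJulia
          (mem_filledJulia_of_mem_fiber hy (hfibmaps hx)) _
      rw [h1.deriv, h4, pow_succ, ← hfd, h2]
      push_cast
      ring

/-- A fiber that returns to itself without critical points has empty interior. -/
theorem IsComplexBoxMapping.not_ball_subset_fiber (hF : IsComplexBoxMapping F U V)
    (hperm : NoPermutation F U) {y : ℂ} (hy : y ∈ filledJulia F U V) {l : ℕ}
    (hly : F^[l] y ∈ fiber F U V y) (hl : 0 < l)
    (hcrit : ∀ i < l, ∀ c ∈ critPoints F U, c ∉ fiber F U V (F^[i] y)) {ρ : ℝ} (hρ : 0 < ρ) :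
    ¬ Metric.ball y ρ ⊆ fiber F U V y := by
  intro hball
  obtain ⟨n, δ, hδ, t, ht, hdisk⟩ := hF.exists_disk_with_large_deriv hperm hy hly hl hcrit
  obtain ⟨M, hM⟩ := Metric.isBounded_iff.mp hF.isBounded_codom
  have hfV : fiber F U V y ⊆ V := fun x hx =>
    hF.piece_subset_codom 0 y ((mem_fiber_iff hy).mp hx 0)
  -- Cauchy's estimate bounds the two derivatives by `M / δ` and `M / ρ` for every `m`, while their
  -- product is `(1 + t) ^ m`.
  obtain ⟨m, hm⟩ := pow_unbounded_of_one_lt (M / δ * (M / ρ)) (show 1 < 1 + t by linarith)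
  obtain ⟨f, hf, hfm, hf0, hfd⟩ := hdisk m y (mem_fiber_self y)
  have hM0 : 0 ≤ M := dist_nonneg.trans (hM (hfV (mem_fiber_self y)) (hfV (mem_fiber_self y)))
  have h1 : ‖deriv f 0‖ ≤ M / δ :=
    Complex.norm_deriv_le_div_of_mapsTo_ball hf (fun w hw => hM
      (hF.piece_subset_codom _ _ (hfm hw))
      (hF.piece_subset_codom _ _ (hfm (Metric.mem_ball_self hδ)))) hδ
  have hmaps := hF.iterate_mul_mem_fiber hy (mem_fiber_self y) hly m
  rw [mul_comm] at hmaps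
  have h2 : ‖deriv F^[l * m] y‖ ≤ M / ρ := by
    refine Complex.norm_deriv_le_div_of_mapsTo_ball ((hF.differentiableOn_iterate (l * m)).mono
      fun w hw => mem_iterPreimage_of_mem_filledJulia
        (mem_filledJulia_of_mem_fiber hy (hball hw)) _) (fun w hw => hM
      (hfV (hmaps (hball hw))) (hfV (hmaps (mem_fiber_self y)))) hρ
  rw [← Function.iterate_mul] at hfd
  have h3 := congrArg norm hfd
  rw [norm_mul, norm_pow, Complex.norm_real, Real.norm_of_nonneg (by linarith)] at h3
  rw [← h3] at hm
  exact absurd hm (not_lt.mpr (by gcongr))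

theorem subset_fiber_of_isPreconnected
    {S : Set ℂ} (hS : IsPreconnected S) (hSK : S ⊆ filledJulia F U V) {a : ℂ} (ha : a ∈ S) :
    S ⊆ fiber F U V a := by
  rw [fiber_eq (hSK ha)]
  exact subset_iInter fun n => hS.subset_connectedComponentIn ha
    fun x hx => mem_iterPreimage_of_mem_filledJulia (hSK hx) n

/-- Inverse branches of iterates along an orbit that avoids the critical fibers contract. -/
theorem IsComplexBoxMapping.tendsto_deriv_inverseBranch (hF : IsComplexBoxMapping F U V)
    (hperm : NoPermutation F U) {z : ℂ} (hz : z ∈ filledJulia F U V)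
    (havoid : AvoidsCriticalFibers F U V z) {k : ℕ → ℕ} (hk : Tendsto k atTop atTop) {y : ℂ}
    (hy : Tendsto (fun j => F^[k j] z) atTop (𝓝 y)) {r : ℝ} (hr : 0 < r) {φ : ℕ → ℂ → ℂ}
    (hφ : ∀ j, IsInverseBranch F^[k j] (φ j) (iterPreimage F U V (k j)) (F^[k j] z) r)
    (hφz : ∀ j, φ j (F^[k j] z) = z) :
    Tendsto (fun j => ‖deriv (φ j) (F^[k j] z)‖) atTop (𝓝 0) := by
  by_contra hcon
  obtain ⟨δ, hδ, hfreq⟩ : ∃ δ > 0, ∃ᶠ j in atTop, δ ≤ ‖deriv (φ j) (F^[k j] z)‖ := by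
    rw [Metric.tendsto_nhds] at hcon
    push Not at hcon
    obtain ⟨δ, hδ, h⟩ := hcon
    exact ⟨δ, hδ, h.mono fun j hj => by simpa using hj⟩
  obtain ⟨M, hM⟩ := Metric.isBounded_iff.mp hF.isBounded_codom
  have hVmem : ∀ n, iterPreimage F U V n ⊆ V := fun n =>
    hF.iterPreimage_antitone (Nat.zero_le n)
  have hzV : z ∈ V := hVmem 0 (mem_iterPreimage_of_mem_filledJulia hz 0)
  set ρ := r * δ / 468 with hρ
  have hρ0 : 0 < ρ := by positivity
  set D := Metric.ball z ρ with hD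
  -- disks of a definite size are covered
  have hcover : ∀ j, δ ≤ ‖deriv (φ j) (F^[k j] z)‖ →
      D ⊆ φ j '' Metric.ball (F^[k j] z) r := by
    intro j hj
    have h1 := ball_subset_image_of_univalent hr (hφ j).differentiableOn (g := F^[k j])
      (fun w hw => (hF.differentiableOn_iterate (k j)).differentiableAt
        ((hF.isOpen_iterPreimage _).mem_nhds ((hφ j).mapsTo hw))) (hφ j).rightInv
      (nonempty_compl_of_isBounded (hF.isBounded_codom.subset
        ((hφ j).mapsTo.image_subset.trans (hVmem _))))
    rw [hφz] at h1
    refine (Metric.ball_subset_ball ?_).trans h1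
    rw [hρ]
    gcongr
  -- By the Schwarz lemma, `φ j y` is within `M / r * dist y (F^[k j] z)` of `z`.
  have hev : ∀ᶠ j in atTop, y ∈ Metric.ball (F^[k j] z) r ∧ φ j y ∈ D := by
    have h1 : Tendsto (fun j => dist y (F^[k j] z)) atTop (𝓝 0) := by
      simpa using (tendsto_const_nhds (x := y)).dist hy
    have h2 : Tendsto (fun j => M / r * dist y (F^[k j] z)) atTop (𝓝 0) := by
      simpa using h1.const_mul (M / r)
    filter_upwards [h1.eventually (gt_mem_nhds hr), h2.eventually (gt_mem_nhds hρ0)] with j h3 h4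
    refine ⟨h3, ?_⟩
    have h5 := Complex.dist_le_div_mul_dist_of_mapsTo_ball (hφ j).differentiableOn
      (R₂ := M) (fun w hw => hM (hVmem _ ((hφ j).mapsTo hw)) (by rw [hφz]; exact hzV)) h3
    rw [hφz] at h5
    exact h5.trans_lt h4
  have hQ := hfreq.and_eventually hev
  -- The fixed disk `D` lies in the range of inverse branches of arbitrarily late iterates, so all
  -- iterates are defined on it.
  have hDK : D ⊆ filledJulia F U V := by
    intro x hx
    refine mem_iInter.mpr fun n => ?_
    obtain ⟨j, ⟨hj, -⟩, hn⟩ := (hQ.and_eventually (hk.eventually_ge_atTop n)).exists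
    obtain ⟨w, hw, rfl⟩ := hcover j hj hx
    exact hF.iterPreimage_antitone hn ((hφ j).mapsTo hw)
  have hDconn : ∀ i, IsPreconnected (F^[i] '' D) := fun i =>
    (convex_ball z ρ).isPreconnected.image _ ((hF.differentiableOn_iterate i).continuousOn.mono
      fun x hx => mem_iterPreimage_of_mem_filledJulia (hDK hx) i)
  -- At both times `k a < k b` the image of `D` lies in the fiber of `y`, so this fiber returns to
  -- itself. It contains a disk at `y`, because `φ a` sends a neighbourhood of `y` into `D`.
  obtain ⟨a, ha, hya, hφa⟩ := hQ.exists
  obtain ⟨b, ⟨hb, hyb, hφb⟩, hab⟩ := (hQ.and_eventually (hk.eventually_gt_atTop (k a))).exists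
  have hyK : y ∈ filledJulia F U V := by
    rw [← (hφ a).rightInv y hya]
    exact iterate_mem_filledJulia (hDK hφa) _
  have hsubfib : ∀ j, y ∈ Metric.ball (F^[k j] z) r → φ j y ∈ D →
      F^[k j] '' D ⊆ fiber F U V y := fun j hyj hφj =>
    subset_fiber_of_isPreconnected (hDconn _)
      (by
        rintro _ ⟨x, hx, rfl⟩
        exact iterate_mem_filledJulia (hDK hx) _)
      ⟨φ j y, hφj, (hφ j).rightInv y hyj⟩
  have hzD : z ∈ D := Metric.mem_ball_self hρ0
  have hza := hsubfib a hya hφa ⟨z, hzD, rfl⟩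
  have hzb := hsubfib b hyb hφb ⟨z, hzD, rfl⟩
  have hly : F^[k b - k a] y ∈ fiber F U V y := by
    have h1 := hF.mapsTo_fiber hyK (k b - k a) hza
    rw [← Function.iterate_add_apply, Nat.sub_add_cancel hab.le] at h1
    have h2 := fiber_eq_of_mem (iterate_mem_filledJulia hyK _) h1
    rw [← fiber_eq_of_mem hyK hzb, h2]
    exact mem_fiber_self _
  have hopen : IsOpen (Metric.ball (F^[k a] z) r ∩ φ a ⁻¹' D) :=
    (hφ a).differentiableOn.continuousOn.isOpen_inter_preimage Metric.isOpen_ball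
      Metric.isOpen_ball
  obtain ⟨ρ', hρ', hsub⟩ := Metric.isOpen_iff.mp hopen y ⟨hya, hφa⟩
  refine hF.not_ball_subset_fiber hperm hyK hly (Nat.sub_pos_of_lt hab) ?_ hρ' fun w hw => ?_
  · intro i hi c hc hcf
    have hiK := iterate_mem_filledJulia hyK i
    refine havoid c hc (mem_filledJulia_of_mem_fiber hiK hcf) (i + k a) ?_
    rw [fiber_eq_of_mem hiK hcf, Function.iterate_add_apply]
    exact hF.mapsTo_fiber hyK i hza
  · refine hsubfib a hya hφa ⟨φ a w, (hsub hw).2, (hφ a).rightInv w (hsub hw).1⟩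

end BoxMap

/-! ### Transporting density over a connected open set. -/

/-- The real Jacobian of a holomorphic map is `|G'|²`; no injectivity is needed for an upper bound.
-/
theorem volume_image_le_of_norm_deriv_le {G : ℂ → ℂ} {S : Set ℂ} {L : ℝ}
    (hS : NullMeasurableSet S volume) (hGS : ∀ x ∈ S, DifferentiableAt ℂ G x)
    (hL : ∀ x ∈ S, ‖deriv G x‖ ≤ L) :
    volume (G '' S) ≤ ENNReal.ofReal (L ^ 2) * volume S := by
  obtain ⟨T, hTS, hT, hTeq⟩ := hS.exists_measurable_subset_ae_eq
  have hnull : volume (G '' (S \ T)) = 0 := by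
    refine addHaar_image_eq_zero_of_differentiableOn_of_addHaar_eq_zero volume
      (fun x hx => ((hGS x hx.1).restrictScalars ℝ).differentiableWithinAt) ?_
    exact (ae_le_set.mp hTeq.symm.le)
  have h1 : volume (G '' T) ≤ ENNReal.ofReal (L ^ 2) * volume S := by
    refine (addHaar_image_le_lintegral_abs_det_fderiv volume hT (f' := fun x =>
      (ContinuousLinearMap.toSpanSingleton ℂ (deriv G x)).restrictScalars ℝ)
      fun x hx => (((hGS x (hTS hx)).hasDerivAt.hasFDerivAt).restrictScalars
        ℝ).hasFDerivWithinAt).trans ?_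
    calc ∫⁻ x in T, ENNReal.ofReal
          |((ContinuousLinearMap.toSpanSingleton ℂ (deriv G x)).restrictScalars ℝ).det|
        ≤ ∫⁻ _ in T, ENNReal.ofReal (L ^ 2) := by
          refine setLIntegral_mono' hT fun x hx => ENNReal.ofReal_le_ofReal ?_
          have hdet : ((ContinuousLinearMap.toSpanSingleton ℂ (deriv G x)).restrictScalars
              ℝ).det = ‖deriv G x‖ ^ 2 := by
            simp [ContinuousLinearMap.det, LinearMap.det_restrictScalars,
              Algebra.norm_complex_eq, Complex.normSq_eq_norm_sq]
          rw [hdet, abs_of_nonneg (by positivity)]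
          have := hL x (hTS hx)
          gcongr
      _ = ENNReal.ofReal (L ^ 2) * volume T := by simp
      _ ≤ ENNReal.ofReal (L ^ 2) * volume S := by gcongr
  calc volume (G '' S) ≤ volume (G '' T ∪ G '' (S \ T)) := by
        refine measure_mono ?_
        rw [← image_union, union_sdiff_cancel hTS]
    _ ≤ volume (G '' T) + volume (G '' (S \ T)) := measure_union_le _ _
    _ ≤ ENNReal.ofReal (L ^ 2) * volume S := by rw [hnull, add_zero]; exact h1

/-- The map `G` attains `w` at a point of `A` whose distance to `z` is `O(s)` and where the
derivative is comparable to `s⁻¹`, with constant `C`. -/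
def ComparablePreimage (G : ℂ → ℂ) (A : Set ℂ) (z : ℂ) (s C : ℝ) (w : ℂ) : Prop :=
  ∃ x ∈ A, G x = w ∧ ‖x - z‖ ≤ C * s ∧ ‖deriv G x‖⁻¹ ≤ C * s ∧ ‖deriv G x‖ ≤ C / s

/-- Bounded distortion spreads comparability from `w` to a disk about it. The new constant depends
only on `C` and `R`, so it is uniform along a sequence of maps. -/
theorem ComparablePreimage.exists_inverseBranch {G : ℂ → ℂ} {A Q : Set ℂ} (hA : IsOpen A)
    (hAb : Bornology.IsBounded A) (hG : DifferentiableOn ℂ G A)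
    (hlift : ∀ w r, 0 < r → Metric.ball w r ⊆ Q → ∀ x ∈ A, G x = w →
      ∃ φ, IsInverseBranch G φ A w r ∧ φ w = x) {z w : ℂ} {s C R : ℝ} (hC : 0 < C) (hs : 0 < s)
    (hR : 0 < R) (hball : Metric.ball w R ⊆ Q) (h : ComparablePreimage G A z s C w) :
    ∃ φ, IsInverseBranch G φ A w R ∧ ∀ v ∈ Metric.ball w (R / 72),
      ‖φ v - z‖ ≤ C * (1 + 26 * R + 1872) * s ∧
      ‖deriv G (φ v)‖⁻¹ ≤ C * (1 + 26 * R + 1872) * s ∧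
      ‖deriv G (φ v)‖ ≤ C * (1 + 26 * R + 1872) / s := by
  obtain ⟨x, hx, hGx, h1, h2, h3⟩ := h
  obtain ⟨φ, hφ, hφw⟩ := hlift w R hR hball x hx hGx
  refine ⟨φ, hφ, fun v hv => ?_⟩
  have hGd : ∀ u ∈ Metric.ball w R, DifferentiableAt ℂ G (φ u) := fun u hu =>
    hG.differentiableAt (hA.mem_nhds (hφ.mapsTo hu))
  have hne := nonempty_compl_of_isBounded (hAb.subset hφ.mapsTo.image_subset)
  have hinv : ∀ u ∈ Metric.ball w R, ‖deriv G (φ u)‖⁻¹ = ‖deriv φ u‖ := by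
    intro u hu
    have h4 := congrArg norm (deriv_mul_deriv_of_leftInverse Metric.isOpen_ball
      hφ.differentiableOn hGd hφ.rightInv hu)
    rw [norm_mul, norm_one] at h4
    exact inv_eq_of_mul_eq_one_right h4
  have hwR : w ∈ Metric.ball w R := Metric.mem_ball_self hR
  have hvR : v ∈ Metric.ball w R := Metric.ball_subset_ball (by linarith) hv
  have hw := hinv w hwR
  rw [hφw] at hw
  have h5 := norm_sub_le_of_univalent hR hφ.differentiableOn hGd hφ.rightInv hne (x := v)
    (Metric.ball_subset_ball (by linarith) hv)
  have h6 := norm_deriv_le_of_univalent hR hφ.differentiableOn hGd hφ.rightInv hne (x := v)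
    (Metric.ball_subset_ball (by linarith) hv)
  have h7 := norm_deriv_center_le_of_univalent hR hφ.differentiableOn hGd hφ.rightInv hne hv
  rw [← hw] at h5 h6 h7
  rw [hφw] at h5
  have hCs : 0 < C * s := by positivity
  refine ⟨?_, ?_, ?_⟩
  · have e : φ v - z = (φ v - x) + (x - z) := by ring
    rw [e]
    refine (norm_add_le _ _).trans ?_
    have h8 : 26 * R * ‖deriv G x‖⁻¹ ≤ 26 * R * (C * s) := by gcongr
    nlinarith
  · rw [hinv v hvR]
    nlinarith
  · have hpos : ∀ u ∈ Metric.ball w R, 0 < ‖deriv G (φ u)‖ := fun u hu => by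
      refine norm_pos_iff.mpr fun h0 => ?_
      have h4 := deriv_mul_deriv_of_leftInverse Metric.isOpen_ball
        hφ.differentiableOn hGd hφ.rightInv hu
      rw [h0, zero_mul] at h4
      exact zero_ne_one h4
    have hx0 := hpos w hwR
    rw [hφw] at hx0
    have hv0 := hpos v hvR
    rw [← hinv v hvR] at h7
    have h9 : ‖deriv G (φ v)‖ ≤ 1872 * ‖deriv G x‖ := by
      rw [← div_eq_mul_inv, inv_le_iff_one_le_mul₀ hx0, div_mul_eq_mul_div,
        le_div_iff₀ hv0] at h7
      linarith
    refine h9.trans ?_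
    calc 1872 * ‖deriv G x‖ ≤ 1872 * (C / s) := by gcongr
      _ = C * 1872 / s := by ring
      _ ≤ C * (1 + 26 * R + 1872) / s := by gcongr; linarith

/-- If maps `G j` without critical points blow up neighbourhoods of a density point `z` of an
invariant set `X`, at a rate prescribed at one point of a connected open set `Q`, then `X` has full
measure in `Q`. -/
theorem volume_diff_eq_zero_of_comparablePreimage {G : ℕ → ℂ → ℂ} {A : ℕ → Set ℂ} {Q X : Set ℂ}
    (hQ : IsOpen Q) (hQc : IsPreconnected Q) (hA : ∀ j, IsOpen (A j))
    (hAb : ∀ j, Bornology.IsBounded (A j)) (hG : ∀ j, DifferentiableOn ℂ (G j) (A j))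
    (hlift : ∀ j w r, 0 < r → Metric.ball w r ⊆ Q → ∀ x ∈ A j, G j x = w →
      ∃ φ, IsInverseBranch (G j) φ (A j) w r ∧ φ w = x)
    (hX : NullMeasurableSet X volume) (hGX : ∀ j, MapsTo (G j) (A j ∩ X) X) {z : ℂ}
    (hdens : Tendsto (fun r => volume (Metric.closedBall z r \ X) /
      volume (Metric.closedBall z r)) (𝓝[>] 0) (𝓝 0)) {s : ℕ → ℝ} (hs : ∀ j, 0 < s j)
    (hs0 : Tendsto s atTop (𝓝 0)) {w₀ : ℂ} (hw₀ : w₀ ∈ Q) {C₀ : ℝ} (hC₀ : 0 < C₀)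
    (hstart : ∀ j, ComparablePreimage (G j) (A j) z (s j) C₀ w₀) :
    volume (Q \ X) = 0 := by
  set T : Set ℂ := {w | ∃ C > 0, ∀ j, ComparablePreimage (G j) (A j) z (s j) C w} with hT
  have hprop : ∀ w ∈ T, ∀ R > 0, Metric.ball w R ⊆ Q → Metric.ball w (R / 72) ⊆ T := by
    rintro w ⟨C, hC, hw⟩ R hR hball v hv
    refine ⟨C * (1 + 26 * R + 1872), by positivity, fun j => ?_⟩
    obtain ⟨φ, hφ, h⟩ := (hw j).exists_inverseBranch (hA j) (hAb j) (hG j) (hlift j) hC (hs j)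
      hR hball
    have hvR : v ∈ Metric.ball w R := Metric.ball_subset_ball (by linarith) hv
    exact ⟨φ v, hφ.mapsTo hvR, hφ.rightInv v hvR, h v hv⟩
  -- Comparability with a constant uniform in `j` is an open and closed condition in the connected
  -- set `Q`.
  have hQT : Q ⊆ T := by
    have hu : IsOpen (Q ∩ T) := by
      rw [Metric.isOpen_iff]
      rintro w ⟨hwQ, hwT⟩
      obtain ⟨R, hR, hball⟩ := Metric.isOpen_iff.mp hQ w hwQ
      exact ⟨R / 72, by positivity, fun v hv =>
        ⟨hball (Metric.ball_subset_ball (by linarith) hv), hprop w hwT R hR hball hv⟩⟩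
    have hv : IsOpen (Q \ T) := by
      rw [Metric.isOpen_iff]
      rintro w ⟨hwQ, hwT⟩
      obtain ⟨R, hR, hball⟩ := Metric.isOpen_iff.mp hQ w hwQ
      -- The distance `R / 200` is below `(R / 2) / 72`, so the disk of radius `R / 2` about `v`
      -- propagates comparability back to `w`.
      refine ⟨R / 200, by positivity, fun v hv =>
        ⟨hball (Metric.ball_subset_ball (by linarith) hv), fun hvT => hwT ?_⟩⟩
      have hd := Metric.mem_ball.mp hv
      refine hprop v hvT (R / 2) (by positivity)
        ((Metric.ball_subset_ball' (by linarith)).trans hball) ?_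
      rw [Metric.mem_ball, dist_comm]
      linarith
    have h1 : Q ⊆ Q ∩ T := by
      refine hQc.subset_left_of_subset_union hu hv ?_ (fun w hw => ?_) ⟨w₀, hw₀, hw₀, C₀, hC₀,
        hstart⟩
      · exact Set.disjoint_left.mpr fun w h1 h2 => h2.2 h1.2
      · by_cases h : w ∈ T
        · exact Or.inl ⟨hw, h⟩
        · exact Or.inr ⟨hw, h⟩
    exact h1.trans inter_subset_right
  refine measure_null_of_locally_null _ fun w hw => ?_
  obtain ⟨R, hR, hball⟩ := Metric.isOpen_iff.mp hQ w hw.1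
  refine ⟨Metric.ball w (R / 72) \ X, ?_, ?_⟩
  · refine mem_nhdsWithin.mpr ⟨Metric.ball w (R / 72), Metric.isOpen_ball,
      Metric.mem_ball_self (by positivity), fun v hv => ⟨hv.1, hv.2.2⟩⟩
  obtain ⟨C, hC, hCw⟩ := hQT hw.1
  set C' := C * (1 + 26 * R + 1872) with hC'
  have hC'0 : 0 < C' := by positivity
  -- By invariance, points outside `X` have preimages outside `X`, here within `C' * s j` of `z`.
  -- The factor `(C' / s j) ^ 2` for areas times the area `π (C' * s j) ^ 2` gives the constant.
  have hbound : ∀ j, volume (Metric.ball w (R / 72) \ X) ≤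
      ENNReal.ofReal (C' ^ 4 * Real.pi) * (volume (Metric.closedBall z (C' * s j) \ X) /
        volume (Metric.closedBall z (C' * s j))) := by
    intro j
    obtain ⟨φ, hφ, h⟩ := (hCw j).exists_inverseBranch (hA j) (hAb j) (hG j) (hlift j) hC (hs j)
      hR hball
    have hsub72 : Metric.ball w (R / 72) ⊆ Metric.ball w R :=
      Metric.ball_subset_ball (by linarith)
    have hGd : ∀ u ∈ Metric.ball w R, DifferentiableAt ℂ (G j) (φ u) := fun u hu =>
      (hG j).differentiableAt ((hA j).mem_nhds (hφ.mapsTo hu))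
    have hopen : IsOpen (φ '' Metric.ball w (R / 72)) := by
      refine isOpen_image_of_deriv_ne_zero Metric.isOpen_ball
        (hφ.differentiableOn.mono hsub72) fun u hu h0 => ?_
      have h4 := deriv_mul_deriv_of_leftInverse Metric.isOpen_ball
        hφ.differentiableOn hGd hφ.rightInv (hsub72 hu)
      rw [h0, mul_zero] at h4
      exact zero_ne_one h4
    have hcov : Metric.ball w (R / 72) \ X ⊆ G j '' (φ '' Metric.ball w (R / 72) \ X) := by
      rintro v ⟨hv, hvX⟩
      have hGv := hφ.rightInv v (hsub72 hv)
      refine ⟨φ v, ⟨⟨v, hv, rfl⟩, fun hφX => hvX ?_⟩, hGv⟩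
      rw [← hGv]
      exact hGX j ⟨hφ.mapsTo (hsub72 hv), hφX⟩
    have hr : 0 < C' * s j := mul_pos hC'0 (hs j)
    have hvol : volume (Metric.closedBall z (C' * s j)) =
        ENNReal.ofReal ((C' * s j) ^ 2 * Real.pi) := by
      rw [Complex.volume_closedBall, ← ENNReal.ofReal_pow hr.le, ENNReal.ofReal_mul (sq_nonneg _)]
      congr 1
      exact (ENNReal.ofReal_coe_nnreal (p := NNReal.pi)).symm
    have hpos : volume (Metric.closedBall z (C' * s j)) ≠ 0 :=
      (Metric.measure_closedBall_pos _ _ hr).ne'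
    have hfin : volume (Metric.closedBall z (C' * s j)) ≠ ∞ := measure_closedBall_lt_top.ne
    calc volume (Metric.ball w (R / 72) \ X)
        ≤ volume (G j '' (φ '' Metric.ball w (R / 72) \ X)) := measure_mono hcov
      _ ≤ ENNReal.ofReal ((C' / s j) ^ 2) * volume (φ '' Metric.ball w (R / 72) \ X) := by
          refine volume_image_le_of_norm_deriv_le
            (hopen.measurableSet.nullMeasurableSet.diff hX) ?_ ?_
          · rintro _ ⟨⟨v, hv, rfl⟩, -⟩
            exact hGd v (hsub72 hv)
          · rintro _ ⟨⟨v, hv, rfl⟩, -⟩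
            exact (h v hv).2.2
      _ ≤ ENNReal.ofReal ((C' / s j) ^ 2) * volume (Metric.closedBall z (C' * s j) \ X) := by
          gcongr
          rintro _ ⟨v, hv, rfl⟩
          rw [Metric.mem_closedBall, dist_eq_norm]
          exact (h v hv).1
      _ = ENNReal.ofReal ((C' / s j) ^ 2) * (volume (Metric.closedBall z (C' * s j)) *
            (volume (Metric.closedBall z (C' * s j) \ X) /
              volume (Metric.closedBall z (C' * s j)))) := by
          rw [ENNReal.mul_div_cancel hpos hfin]
      _ = _ := by
          rw [← mul_assoc, hvol, ← ENNReal.ofReal_mul (by positivity)]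
          congr 2
          have := (hs j).ne'
          field_simp
  have hlim : Tendsto (fun j => ENNReal.ofReal (C' ^ 4 * Real.pi) *
      (volume (Metric.closedBall z (C' * s j) \ X) /
        volume (Metric.closedBall z (C' * s j)))) atTop (𝓝 0) := by
    have h1 : Tendsto (fun j => C' * s j) atTop (𝓝[>] 0) := by
      refine tendsto_nhdsWithin_iff.mpr ⟨by simpa using hs0.const_mul C', ?_⟩
      exact Eventually.of_forall fun j => mul_pos hC'0 (hs j)
    have h2 := ENNReal.Tendsto.const_mul (a := ENNReal.ofReal (C' ^ 4 * Real.pi))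
      (hdens.comp h1) (Or.inr ENNReal.ofReal_ne_top)
    rwa [mul_zero] at h2
  exact le_antisymm (ge_of_tendsto' hlim hbound) zero_le

theorem exists_inverseBranch_of_proper {A Q : Set ℂ} {G : ℂ → ℂ} (hA : IsOpen A)
    (hQ : IsOpen Q) (hG : DifferentiableOn ℂ G A) (hmaps : MapsTo G A Q)
    (hcrit : ∀ x ∈ A, deriv G x ≠ 0)
    (hproper : ∀ K ⊆ Q, IsCompact K → IsCompact (A ∩ G ⁻¹' K)) (w : ℂ) (r : ℝ) (hr : 0 < r)
    (hball : Metric.ball w r ⊆ Q) (x : ℂ) (hx : x ∈ A) (hGx : G x = w) :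
    ∃ φ, IsInverseBranch G φ A w r ∧ φ w = x := by
  obtain ⟨φ, h1, h2, h3, h4⟩ := exists_holomorphic_lift hA hQ hG hmaps hcrit hproper hr
    (f := id) differentiableOn_id (fun v hv => hball hv) hx hGx
  exact ⟨φ, ⟨h1, h2, h3⟩, h4⟩

/-! ### Full measure in a puzzle piece from unbranched pullbacks. -/

namespace BoxMap

variable {F : ℂ → ℂ} {U V : Set ℂ}

/-- The pullback of the disk `ball y r` by `F^[k]` along the orbit of `z`, inside the piece of depth
`n + k`, meets no critical point. -/
def UnbranchedPullback (F : ℂ → ℂ) (U V : Set ℂ) (n k : ℕ) (z y : ℂ) (r : ℝ) : Prop :=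
  ∀ x ∈ connectedComponentIn (piece F U V (n + k) z ∩ F^[k] ⁻¹' Metric.ball y r) z,
    ∀ i < k, F^[i] x ∉ critPoints F U

/-- The iterate is proper from the component of the preimage onto its disk of values; without
critical points there, lifting the identity gives the branch. -/
theorem IsComplexBoxMapping.exists_inverseBranch_of_unbranchedPullback
    (hF : IsComplexBoxMapping F U V) {n k : ℕ} {z y : ℂ} {r : ℝ}
    (hz : z ∈ iterPreimage F U V (n + k)) (hball : Metric.ball y r ⊆ piece F U V n (F^[k] z))
    (h : UnbranchedPullback F U V n k z y r) (w : ℂ) (s : ℝ) (hs : 0 < s)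
    (hws : Metric.ball w s ⊆ Metric.ball y r) (x : ℂ)
    (hx : x ∈ connectedComponentIn (piece F U V (n + k) z ∩ F^[k] ⁻¹' Metric.ball y r) z)
    (hxw : F^[k] x = w) :
    ∃ φ, IsInverseBranch F^[k] φ
      (connectedComponentIn (piece F U V (n + k) z ∩ F^[k] ⁻¹' Metric.ball y r) z) w s ∧
        φ w = x := by
  have hsub : piece F U V (n + k) z ⊆ iterPreimage F U V k :=
    (piece_subset _ _).trans (hF.iterPreimage_antitone (by omega))
  have hdiff := (hF.differentiableOn_iterate k).mono hsub
  have hopen : IsOpen (piece F U V (n + k) z ∩ F^[k] ⁻¹' Metric.ball y r) :=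
    hdiff.continuousOn.isOpen_inter_preimage (hF.isOpen_piece _ _) Metric.isOpen_ball
  have hC := connectedComponentIn_subset (piece F U V (n + k) z ∩ F^[k] ⁻¹' Metric.ball y r) z
  refine exists_inverseBranch_of_proper hopen.connectedComponentIn Metric.isOpen_ball
    (hdiff.mono (hC.trans inter_subset_left)) (fun x hx => (hC hx).2)
    (fun x hx => hF.deriv_iterate_ne_zero (hsub (hC hx).1) (h x hx)) (fun K hK hKc => ?_)
    w s hs hws x hx hxw
  have h1 := (hF.isCompact_piece_inter hz (hK.trans hball) hKc).connectedComponentIn_inter z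
    (S := piece F U V (n + k) z ∩ F^[k] ⁻¹' Metric.ball y r)
    (inter_subset_inter_right _ (preimage_mono hK))
  convert h1 using 1
  exact Subset.antisymm (fun v hv => ⟨hv.1, (hC hv.1).1, hv.2⟩) (fun v hv => ⟨hv.1, hv.2.2⟩)

/-- The density argument: the invariant set has full measure in a puzzle piece `piece n y` whose
pullbacks along the orbit of a density point are unbranched away from a finite set `E` of values. -/
theorem IsComplexBoxMapping.volume_piece_diff_eq_zero (hF : IsComplexBoxMapping F U V)
    (hperm : NoPermutation F U) {X : Set ℂ} (hX : NullMeasurableSet X volume)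
    (hFX : MapsTo F X X) {z : ℂ} (hz : z ∈ filledJulia F U V)
    (havoid : AvoidsCriticalFibers F U V z)
    (hdens : Tendsto (fun r => volume (Metric.closedBall z r \ X) /
      volume (Metric.closedBall z r)) (𝓝[>] 0) (𝓝 0)) {n : ℕ} {y : ℂ} {r : ℝ} (hr : 0 < r)
    (hball : Metric.ball y r ⊆ piece F U V n y) {E : Set ℂ} (hE : E.Finite)
    (hfreq : ∀ ρ > 0, ∃ᶠ k in atTop, F^[k] z ∈ Metric.ball y ρ ∧
      UnbranchedPullback F U V n k z y r)
    (hcritE : ∀ k, F^[k] z ∈ piece F U V n y → ∀ x ∈ piece F U V (n + k) z, F^[k] x ∉ E →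
      ∀ i < k, F^[i] x ∉ critPoints F U) :
    volume (piece F U V n y \ X) = 0 := by
  have hseq : ∀ j : ℕ, ∃ k ≥ j, F^[k] z ∈ Metric.ball y (min (1 / ((j : ℝ) + 1)) (r / 288)) ∧
      UnbranchedPullback F U V n k z y r := fun j =>
    ((hfreq _ (by positivity)).and_eventually (eventually_ge_atTop j)).exists.imp
      fun k hk => ⟨hk.2, hk.1⟩
  choose k hkj hkz hkU using hseq
  have hk : Tendsto k atTop atTop := tendsto_atTop_mono hkj tendsto_id
  have hk288 : ∀ j, F^[k j] z ∈ Metric.ball y (r / 288) := fun j =>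
    Metric.ball_subset_ball (min_le_right _ _) (hkz j)
  have hlim : Tendsto (fun j => F^[k j] z) atTop (𝓝 y) := by
    rw [tendsto_iff_dist_tendsto_zero]
    refine squeeze_zero (fun _ => dist_nonneg) (fun j => ?_) tendsto_one_div_add_atTop_nhds_zero_nat
    exact (lt_of_lt_of_le (Metric.mem_ball.mp (hkz j)) (min_le_left _ _)).le
  have hmem : ∀ m, z ∈ iterPreimage F U V m := mem_iterPreimage_of_mem_filledJulia hz
  have hkr : ∀ j, F^[k j] z ∈ Metric.ball y r := fun j =>
    Metric.ball_subset_ball (by linarith) (hk288 j)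
  have hpiece : ∀ j, piece F U V n (F^[k j] z) = piece F U V n y := fun j =>
    piece_eq (hball (hkr j))
  have hhalf : ∀ j, Metric.ball (F^[k j] z) (r / 2) ⊆ Metric.ball y r := fun j => by
    refine Metric.ball_subset_ball' ?_
    have := Metric.mem_ball.mp (hk288 j)
    linarith
  set C : ℕ → Set ℂ := fun j =>
    connectedComponentIn (piece F U V (n + k j) z ∩ F^[k j] ⁻¹' Metric.ball y r) z with hCdef
  have hCsub : ∀ j, C j ⊆ piece F U V (n + k j) z ∩ F^[k j] ⁻¹' Metric.ball y r := fun j =>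
    connectedComponentIn_subset _ _
  have hzC : ∀ j, z ∈ C j := fun j => mem_connectedComponentIn ⟨mem_piece (hmem _), hkr j⟩
  have hsub : ∀ j, piece F U V (n + k j) z ⊆ iterPreimage F U V (k j) := fun j =>
    (piece_subset _ _).trans (hF.iterPreimage_antitone (by omega))
  have hdiff := fun j => (hF.differentiableOn_iterate (k j)).mono (hsub j)
  have hCo : ∀ j, IsOpen (C j) := fun j => ((hdiff j).continuousOn.isOpen_inter_preimage
    (hF.isOpen_piece _ _) Metric.isOpen_ball).connectedComponentIn
  have hbranch := fun j => hF.exists_inverseBranch_of_unbranchedPullback (hmem (n + k j))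
    (by rw [hpiece j]; exact hball) (hkU j)
  choose φ hφ hφz using fun j => hbranch j (F^[k j] z) (r / 2) (by positivity) (hhalf j) z (hzC j)
    rfl
  -- the contraction rate of the inverse branches
  have hderiv : ∀ j, deriv F^[k j] z * deriv (φ j) (F^[k j] z) = 1 := fun j => by
    have h1 := deriv_mul_deriv_of_leftInverse Metric.isOpen_ball (hφ j).differentiableOn
      (g := F^[k j]) (fun w hw => (hdiff j).differentiableAt
        ((hF.isOpen_piece _ _).mem_nhds (hCsub j ((hφ j).mapsTo hw)).1)) (hφ j).rightInv
      (w := F^[k j] z) (Metric.mem_ball_self (by positivity))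
    rwa [hφz j] at h1
  have hd0 : ∀ j, deriv F^[k j] z ≠ 0 := fun j h0 => by
    have := hderiv j
    rw [h0, zero_mul] at this
    exact zero_ne_one this
  have hs0 : Tendsto (fun j => ‖deriv F^[k j] z‖⁻¹) atTop (𝓝 0) := by
    refine (hF.tendsto_deriv_inverseBranch hperm hz havoid hk hlim (r := r / 2) (by positivity)
      (φ := φ) (fun j => ⟨(hφ j).differentiableOn, fun w hw =>
        hsub j (hCsub j ((hφ j).mapsTo hw)).1, (hφ j).rightInv⟩) hφz).congr fun j => ?_
    rw [← norm_inv, eq_inv_of_mul_eq_one_right (hderiv j)]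
  -- Both `w₀` and `F^[k j] z` are within `r / 288` of `y`, so their distance is less than `(r / 2)
  -- / 72`, the range of the distortion bound. The base point must avoid `E` because propagation
  -- takes place off `E`.
  obtain ⟨w₀, hw₀E, hw₀⟩ : ∃ w₀, w₀ ∉ E ∧ w₀ ∈ Metric.ball y (r / 288) := by
    have h1 : ∃ᶠ w in 𝓝 y, w ∉ E :=
      mem_closure_iff_frequently.mp (hE.countable.dense_compl ℝ y)
    exact (h1.and_eventually (Metric.ball_mem_nhds y (by positivity))).exists
  have hstart : ∀ j, ComparablePreimage F^[k j] (piece F U V (n + k j) z ∩ F^[k j] ⁻¹' Eᶜ) z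
      ‖deriv F^[k j] z‖⁻¹ (1 * (1 + 26 * (r / 2) + 1872)) w₀ := by
    intro j
    have hpos : 0 < ‖deriv F^[k j] z‖⁻¹ := by
      have := hd0 j
      positivity
    have h1 : ComparablePreimage F^[k j] (C j) z ‖deriv F^[k j] z‖⁻¹ 1 (F^[k j] z) :=
      ⟨z, hzC j, rfl, by simp, by simp, by simp⟩
    obtain ⟨ψ, hψ, h⟩ := h1.exists_inverseBranch (hCo j)
      ((hF.isBounded_piece _ _).subset ((hCsub j).trans inter_subset_left))
      ((hdiff j).mono ((hCsub j).trans inter_subset_left)) (hbranch j) one_pos hpos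
      (R := r / 2) (by positivity) (hhalf j)
    have hw72 : w₀ ∈ Metric.ball (F^[k j] z) (r / 2 / 72) := by
      have h2 := Metric.mem_ball.mp hw₀
      have h3 := Metric.mem_ball.mp (hk288 j)
      have h4 := dist_triangle_right w₀ (F^[k j] z) y
      rw [Metric.mem_ball]
      linarith
    have hw2 : w₀ ∈ Metric.ball (F^[k j] z) (r / 2) :=
      Metric.ball_subset_ball (by linarith) hw72
    have hval := hψ.rightInv w₀ hw2
    refine ⟨ψ w₀, ⟨(hCsub j (hψ.mapsTo hw2)).1, ?_⟩, hval, h w₀ hw72⟩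
    rw [mem_preimage, hval]
    exact hw₀E
  have hEc : IsOpen Eᶜ := hE.isClosed.isOpen_compl
  have hAo : ∀ j, IsOpen (piece F U V (n + k j) z ∩ F^[k j] ⁻¹' Eᶜ) := fun j =>
    (hdiff j).continuousOn.isOpen_inter_preimage (hF.isOpen_piece _ _) hEc
  have hQo : IsOpen (piece F U V n y \ E) := (hF.isOpen_piece n y).sdiff hE.isClosed
  have hmaps : ∀ j, MapsTo F^[k j] (piece F U V (n + k j) z) (piece F U V n y) := fun j => by
    rw [← hpiece j]
    exact hF.mapsTo_piece (hmem _)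
  -- Off the finite set `E` of values the iterates are proper and unbranched over the whole piece,
  -- which remains connected.
  have hmain := volume_diff_eq_zero_of_comparablePreimage hQo
    ((isPreconnected_piece n y).diff_countable (hF.isOpen_piece n y) hE.countable) hAo
    (fun j => (hF.isBounded_piece _ _).subset inter_subset_left)
    (fun j => (hdiff j).mono inter_subset_left)
    (fun j => exists_inverseBranch_of_proper (hAo j) hQo ((hdiff j).mono inter_subset_left)
      (fun x hx => ⟨hmaps j hx.1, hx.2⟩)
      (fun x hx => hF.deriv_iterate_ne_zero (hsub j hx.1)
        (hcritE (k j) (hball (hkr j)) x hx.1 hx.2))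
      (fun K hK hKc => by
        have h1 := hF.isCompact_piece_inter (hmem (n + k j)) (K := K)
          (by rw [hpiece j]; exact hK.trans sdiff_subset) hKc
        convert h1 using 1
        exact Subset.antisymm (fun v hv => ⟨hv.1.1, hv.2⟩)
          (fun v hv => ⟨⟨hv.1, (hK hv.2).2⟩, hv.2⟩)))
    hX (fun j x hx => hFX.iterate (k j) hx.2) hdens
    (fun j => by
      have := hd0 j
      positivity) hs0
    ⟨hball (Metric.ball_subset_ball (by linarith) hw₀), hw₀E⟩ (by positivity) hstart
  refine measure_mono_null (t := (piece F U V n y \ E) \ X ∪ E) (fun x hx => ?_)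
    (measure_union_null hmain (hE.measure_zero _))
  by_cases h : x ∈ E
  · exact Or.inr h
  · exact Or.inl ⟨⟨hx.1, h⟩, hx.2⟩

end BoxMap

/-! ### Finding disks with unbranched pullbacks. -/

namespace BoxMap

variable {F : ℂ → ℂ} {U V : Set ℂ}

theorem IsComplexBoxMapping.exists_mapClusterPt_mem_fiber (hF : IsComplexBoxMapping F U V)
    (hperm : NoPermutation F U) {c : ℂ} (hc : c ∈ filledJulia F U V) {u : ℕ → ℂ}
    (hu : ∀ n, u n ∈ piece F U V n c) : ∃ y ∈ fiber F U V c, MapClusterPt y atTop u := by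
  have hle : ∀ {m n}, m ≤ n → u n ∈ piece F U V m c := fun h => hF.piece_antitone c h (hu _)
  obtain ⟨y, -, hy⟩ := (hF.isBounded_piece 0 c).isCompact_closure.exists_mapClusterPt_of_frequently
    (l := atTop) (f := u) (Frequently.of_forall fun n => subset_closure (hle (Nat.zero_le n)))
  refine ⟨y, ?_, hy⟩
  rw [hF.fiber_eq_iInter_closure hperm hc, mem_iInter]
  intro n
  rw [mem_closure_iff_nhds]
  intro t ht
  obtain ⟨m, hm, hmn⟩ := ((mapClusterPt_iff_frequently.mp hy t ht).and_eventually
    (eventually_ge_atTop n)).exists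
  exact ⟨u m, hm, hle hmn⟩

theorem IsComplexBoxMapping.convergesToSet_fiber (hF : IsComplexBoxMapping F U V)
    (hperm : NoPermutation F U) {c : ℂ} (hc : c ∈ filledJulia F U V) {u : ℕ → ℂ}
    (hu : ∀ n, u n ∈ piece F U V n c) : ConvergesToSet u (fiber F U V c) := by
  refine ENNReal.tendsto_nhds_zero.mpr fun ε hε => ?_
  have hO : IsOpen {x | Metric.infEDist x (fiber F U V c) < ε} :=
    isOpen_Iio.preimage Metric.continuous_infEDist
  obtain ⟨n, hn⟩ := hF.exists_piece_subset hperm hc hO fun x hx => by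
    rw [mem_ofPred_eq, Metric.infEDist_zero_of_mem hx]
    exact hε
  filter_upwards [eventually_ge_atTop n] with m hm
  exact le_of_lt (hn (hF.piece_antitone c hm (hu m)))

/-- Each single orbit point lies outside the fiber, hence outside all deep pieces, so entry times
into deeper pieces cannot stay bounded. -/
theorem IsComplexBoxMapping.exists_iterate_tendsto_atTop (hF : IsComplexBoxMapping F U V)
    {z c : ℂ} (hc : c ∈ filledJulia F U V) (havoid : ∀ i, F^[i] z ∉ fiber F U V c)
    (h : ∀ n, ∃ i, F^[i] z ∈ piece F U V n c) :
    ∃ i : ℕ → ℕ, Tendsto i atTop atTop ∧ ∀ n, F^[i n] z ∈ piece F U V n c := by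
  choose i hi using h
  refine ⟨i, tendsto_atTop.mpr fun b => ?_, hi⟩
  have h1 : ∀ j ∈ Iio b, ∀ᶠ n in atTop, F^[j] z ∉ piece F U V n c := by
    intro j _
    have h2 := havoid j
    rw [mem_fiber_iff hc] at h2
    push Not at h2
    obtain ⟨m, hm⟩ := h2
    filter_upwards [eventually_ge_atTop m] with n hn h3 using hm (hF.piece_antitone c hn h3)
  filter_upwards [(eventually_all_finite (finite_Iio b)).mpr h1] with n hn
  by_contra hlt
  exact hn (i n) (not_le.mp hlt) (hi n)

/-- The forward orbit of `F a` meets every puzzle piece around `b`. -/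
def AccumulatesOnFiber (F : ℂ → ℂ) (U V : Set ℂ) (a b : ℂ) : Prop :=
  ∀ n, ∃ k ≥ 1, F^[k] a ∈ piece F U V n b

theorem IsComplexBoxMapping.iterate_add_mem_piece (hF : IsComplexBoxMapping F U V) {x b c : ℂ}
    {n k : ℕ} (hb : b ∈ filledJulia F U V) (hx : x ∈ piece F U V (n + k) b)
    (hbc : F^[k] b ∈ piece F U V n c) : F^[k] x ∈ piece F U V n c := by
  rw [← piece_eq hbc]
  exact hF.mapsTo_piece (mem_iterPreimage_of_mem_filledJulia hb _) hx

theorem IsComplexBoxMapping.accumulatesOnFiber_trans (hF : IsComplexBoxMapping F U V) {a b c : ℂ}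
    (hb : b ∈ filledJulia F U V) (hab : AccumulatesOnFiber F U V a b)
    (hbc : AccumulatesOnFiber F U V b c) : AccumulatesOnFiber F U V a c := by
  intro n
  obtain ⟨k, hk, hkc⟩ := hbc n
  obtain ⟨j, hj, hjb⟩ := hab (n + k)
  refine ⟨k + j, by omega, ?_⟩
  rw [Function.iterate_add_apply]
  exact hF.iterate_add_mem_piece hb hjb hkc

/-- Concatenating returns to sufficiently deep pieces yields arbitrarily late returns to any depth;
compactness then supplies a limit point in the fiber. -/
theorem IsComplexBoxMapping.isRecurrentCriticalFiber_of_accumulates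
    (hF : IsComplexBoxMapping F U V) (hperm : NoPermutation F U) {c : ℂ}
    (hcc : c ∈ critPoints F U) (hc : c ∈ filledJulia F U V)
    (h : AccumulatesOnFiber F U V c c) :
    IsRecurrentCriticalFiber F U V (fiber F U V c) := by
  have h1 : ∀ m n, ∃ k ≥ m, F^[k] c ∈ piece F U V n c := by
    intro m
    induction m with
    | zero =>
      intro n
      obtain ⟨k, -, hk⟩ := h n
      exact ⟨k, Nat.zero_le k, hk⟩
    | succ m ih =>
      intro n
      obtain ⟨k, hk, hkc⟩ := h n
      obtain ⟨j, hj, hjc⟩ := ih (n + k)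
      refine ⟨k + j, by omega, ?_⟩
      rw [Function.iterate_add_apply]
      exact hF.iterate_add_mem_piece hc hjc hkc
  choose k hk hkc using fun n => h1 n n
  exact ⟨⟨c, hcc, hc, rfl⟩, k, tendsto_atTop_mono hk tendsto_id, fun _ => c,
    fun _ => mem_fiber_self c, hF.exists_mapClusterPt_mem_fiber hperm hc hkc⟩

theorem IsComplexBoxMapping.iterate_mem_piece_of_mem_piece (hF : IsComplexBoxMapping F U V)
    {z x : ℂ} (hz : z ∈ filledJulia F U V) {n k i : ℕ} (hik : i ≤ k)
    (hx : x ∈ piece F U V (n + k) z) :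
    F^[i] x ∈ piece F U V (n + (k - i)) (F^[i] z) := by
  have h : n + k = n + (k - i) + i := by omega
  rw [h] at hx
  exact hF.mapsTo_piece (mem_iterPreimage_of_mem_filledJulia hz _) hx

theorem mem_piece_comm {n : ℕ} {x y : ℂ} (hxy : x ∈ piece F U V n y)
    (hy : y ∈ iterPreimage F U V n) : y ∈ piece F U V n x := by
  rw [piece_eq hxy]
  exact mem_piece hy

theorem IsComplexBoxMapping.eventually_notMem_iterPreimage (hF : IsComplexBoxMapping F U V) {c : ℂ}
    (hc : c ∉ filledJulia F U V) : ∀ᶠ n in atTop, c ∉ iterPreimage F U V n := by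
  obtain ⟨n, hn⟩ : ∃ n, c ∉ iterPreimage F U V n := by
    simpa [filledJulia] using hc
  filter_upwards [eventually_ge_atTop n] with m hm h using hn (hF.iterPreimage_antitone hm h)

/-- If the orbit of `z` accumulates on fibers of non-escaping critical points, then it does so on
one near which no such critical orbit returns: a deep piece around it pulls back along the orbit of
`z` without branching. -/
theorem IsComplexBoxMapping.exists_unbranchedPullback_of_critical (hF : IsComplexBoxMapping F U V)
    (hperm : NoPermutation F U) {z : ℂ} (hz : z ∈ ergodicSet F U V)
    (havoid : AvoidsCriticalFibers F U V z)
    (hS : ∃ c ∈ critPoints F U, c ∈ filledJulia F U V ∧ ∀ n, ∃ i, F^[i] z ∈ piece F U V n c) :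
    ∃ (n : ℕ) (y : ℂ) (r : ℝ), y ∈ iterPreimage F U V n ∧ 0 < r ∧
      Metric.ball y r ⊆ piece F U V n y ∧
      (∀ ρ > 0, ∃ᶠ k in atTop, F^[k] z ∈ Metric.ball y ρ ∧ UnbranchedPullback F U V n k z y r) ∧
      ∀ k, F^[k] z ∈ piece F U V n y → ∀ x ∈ piece F U V (n + k) z, ∀ i < k,
        F^[i] x ∉ critPoints F U := by
  set S : Set ℂ := {c | c ∈ critPoints F U ∧ c ∈ filledJulia F U V ∧
    ∀ n, ∃ i, F^[i] z ∈ piece F U V n c} with hSdef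
  have hSfin : Finite S := (hF.finite_crit.subset fun c hc => hc.1).to_subtype
  have hseq : ∀ c ∈ S, ∃ i : ℕ → ℕ, Tendsto i atTop atTop ∧
      ∀ n, F^[i n] z ∈ piece F U V n c := fun c hc =>
    hF.exists_iterate_tendsto_atTop hc.2.1 (havoid c hc.1 hc.2.1) hc.2.2
  let R : S → S → Prop := fun a b => AccumulatesOnFiber F U V a b
  have htrans : IsTrans S R := ⟨fun a b c => hF.accumulatesOnFiber_trans b.2.2.1⟩
  have hirr : Std.Irrefl R := ⟨fun c hcc => by
    obtain ⟨i, hi, hic⟩ := hseq c c.2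
    exact hz.2 (Or.inr (mem_recurrentPoints_of_tendsto hz.1
      (hF.isRecurrentCriticalFiber_of_accumulates hperm c.2.1 c.2.2.1 hcc) hi
      (hF.convergesToSet_fiber hperm c.2.2.1 hic)))⟩
  -- No critical point of `S` accumulates on the fiber of the minimal element `c₀`.
  obtain ⟨⟨c₀, hc₀⟩, -, hmin⟩ := (Finite.wellFounded_of_trans_of_irrefl R).has_min univ
    (by obtain ⟨c, hc⟩ := hS; exact ⟨⟨c, hc⟩, mem_univ _⟩)
  -- At a large common depth, escaping critical points have dropped out, those outside `S` have
  -- pieces missed by the orbit of `z`, and those in `S` never enter the piece of `c₀`.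
  have hev : ∀ᶠ n in atTop, ∀ c ∈ critPoints F U, c ∈ iterPreimage F U V n →
      (∃ i, F^[i] z ∈ piece F U V n c) → ∀ k ≥ 1, F^[k] c ∉ piece F U V n c₀ := by
    refine (eventually_all_finite hF.finite_crit).mpr fun c hc => ?_
    by_cases hcK : c ∈ filledJulia F U V
    · by_cases hcS : c ∈ S
      · have h1 : ¬ AccumulatesOnFiber F U V c c₀ := hmin ⟨c, hcS⟩ (mem_univ _)
        unfold AccumulatesOnFiber at h1
        push Not at h1
        obtain ⟨m, hm⟩ := h1
        filter_upwards [eventually_ge_atTop m] with n hn _ _ k hk h2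
        exact hm k hk (hF.piece_antitone c₀ hn h2)
      · have h1 : ¬ ∀ n, ∃ i, F^[i] z ∈ piece F U V n c := fun h => hcS ⟨hc, hcK, h⟩
        push Not at h1
        obtain ⟨m, hm⟩ := h1
        filter_upwards [eventually_ge_atTop m] with n hn _ h2
        obtain ⟨i, hi⟩ := h2
        exact absurd (hF.piece_antitone c hn hi) (hm i)
    · filter_upwards [hF.eventually_notMem_iterPreimage hcK] with n hn h
      exact absurd h hn
  obtain ⟨M, hM⟩ := hev.exists
  obtain ⟨i, hi, hic⟩ := hseq c₀ hc₀
  obtain ⟨y, hy, hclus⟩ := hF.exists_mapClusterPt_mem_fiber hperm hc₀.2.1 hic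
  have hclus' : MapClusterPt y atTop fun k => F^[k] z :=
    MapClusterPt.of_comp (u := fun k => F^[k] z) hi hclus
  have hyM : y ∈ piece F U V M c₀ := (mem_fiber_iff hc₀.2.1).mp hy M
  have hpy := piece_eq hyM
  obtain ⟨r, hr, hball⟩ := Metric.isOpen_iff.mp (hF.isOpen_piece M c₀) y hyM
  have hcrit : ∀ k, F^[k] z ∈ piece F U V M y → ∀ x ∈ piece F U V (M + k) z, ∀ i < k,
      F^[i] x ∉ critPoints F U := by
    intro k hk x hx i hik hcx
    have h1 := hF.iterate_mem_piece_of_mem_piece hz.1 hik.le hx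
    have hzi := mem_iterPreimage_of_mem_filledJulia (iterate_mem_filledJulia hz.1 i)
    have h2 := hF.piece_antitone _ (Nat.le_add_right M (k - i)) h1
    refine hM _ hcx (piece_subset _ _ h2) ⟨i, mem_piece_comm h2 (hzi M)⟩ (k - i) (by omega) ?_
    have h3 := hF.mapsTo_piece (hzi _) h1
    rw [← Function.iterate_add_apply F (k - i) i z, Nat.sub_add_cancel hik.le, piece_eq hk,
      hpy] at h3
    exact h3
  refine ⟨M, y, r, piece_subset _ _ hyM, hr, by rwa [hpy], fun ρ hρ => ?_, hcrit⟩
  refine (mapClusterPt_iff_frequently.mp hclus' _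
    (Metric.ball_mem_nhds y (lt_min hρ hr))).mono fun k hk => ?_
  refine ⟨Metric.ball_subset_ball (min_le_left _ _) hk, fun x hx => hcrit k ?_ x ?_⟩
  · rw [hpy]
    exact hball (Metric.ball_subset_ball (min_le_right _ _) hk)
  · exact (connectedComponentIn_subset _ _ hx).1

/-- Finitely many critical points exclude local constancy, so values are attained at isolated
points. -/
theorem IsComplexBoxMapping.tendsto_iterate_nhdsNE (hF : IsComplexBoxMapping F U V) {l : ℕ} {c : ℂ}
    (hc : c ∈ iterPreimage F U V l) : Tendsto F^[l] (𝓝[≠] c) (𝓝[≠] (F^[l] c)) := by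
  have h1 : ∀ a ∈ U, Tendsto F (𝓝[≠] a) (𝓝[≠] (F a)) := by
    intro a ha
    have han := hF.holomorphic.analyticAt (hF.isOpen_dom.mem_nhds ha)
    refine tendsto_nhdsWithin_iff.mpr
      ⟨han.continuousAt.tendsto.mono_left nhdsWithin_le_nhds, ?_⟩
    rcases han.eventually_eq_or_eventually_ne (analyticAt_const (v := F a)) with h | h
    · exfalso
      refine infinite_of_mem_nhds a (s := critPoints F U) ?_ hF.finite_crit
      filter_upwards [eventually_eventually_nhds.mpr h, hF.isOpen_dom.mem_nhds ha] with x hx hxU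
      have hx' : F =ᶠ[𝓝 x] fun _ => F a := hx
      exact ⟨hxU, by rw [hx'.deriv_eq, deriv_const]⟩
    · exact h
  induction l generalizing c with
  | zero => exact tendsto_id
  | succ l ih =>
    rw [Function.iterate_succ]
    exact (ih hc.2).comp (h1 c hc.1)

/-- Infinitely many orbit points stay at a definite distance from the frontier, and the part of
`closure V` at that distance is a compact subset of `V`. -/
theorem IsComplexBoxMapping.exists_mapClusterPt_of_notMem_boundaryPoints
    (hF : IsComplexBoxMapping F U V) {z : ℂ} (hz : z ∈ filledJulia F U V) (hzb : z ∉ boundaryPoints F U V) :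
    ∃ y ∈ V, MapClusterPt y atTop fun i => F^[i] z := by
  have h1 : ¬ ConvergesToSet (fun i => F^[i] z) (frontier V) := fun h => hzb ⟨hz, h⟩
  unfold ConvergesToSet at h1
  rw [ENNReal.tendsto_nhds_zero] at h1
  push Not at h1
  obtain ⟨ε, hε, hfr⟩ := h1
  have hcomp : IsCompact (closure V ∩ {x | ε ≤ Metric.infEDist x (frontier V)}) :=
    hF.isBounded_codom.isCompact_closure.inter_right
      (isClosed_Ici.preimage Metric.continuous_infEDist)
  obtain ⟨y, hy, hclus⟩ := hcomp.exists_mapClusterPt_of_frequently (l := atTop)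
    (f := fun i => F^[i] z) (hfr.mono fun i hi => ⟨subset_closure
      (mem_iterPreimage_of_mem_filledJulia (iterate_mem_filledJulia hz i) 0), hi.le⟩)
  refine ⟨y, ?_, hclus⟩
  by_contra hyV
  have hyf : y ∈ frontier V := ⟨hy.1, by rwa [hF.isOpen_codom.interior_eq]⟩
  have h2 : ε ≤ Metric.infEDist y (frontier V) := hy.2
  rw [Metric.infEDist_zero_of_mem hyf] at h2
  exact hε.ne' (nonpos_iff_eq_zero.mp h2)

/-- If all small disks around a limit point `y` of the orbit of `z` have branched pullbacks, and the
branching occurs within `N` steps before the arrival near `y`, then `y` lies on the orbit of a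
critical point which is itself a limit point of the orbit of `z`. -/
theorem IsComplexBoxMapping.exists_critPoint_mapClusterPt (hF : IsComplexBoxMapping F U V)
    {z : ℂ} (hz : z ∈ filledJulia F U V) {N : ℕ}
    (hN : ∀ k, ∀ x ∈ piece F U V (0 + k) z, ∀ i < k, F^[i] x ∈ critPoints F U → k - i < N)
    {y : ℂ} (hy : y ∈ V) (hclus : MapClusterPt y atTop fun i => F^[i] z)
    (hbad : ∀ r > 0, Metric.ball y r ⊆ piece F U V 0 y → ¬ ∀ ρ > 0, ∃ᶠ k in atTop,
      F^[k] z ∈ Metric.ball y ρ ∧ UnbranchedPullback F U V 0 k z y r) :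
    ∃ c ∈ critPoints F U, ∃ l ≥ 1, c ∈ iterPreimage F U V l ∧ F^[l] c = y ∧
      MapClusterPt c atTop fun i => F^[i] z := by
  obtain ⟨r₀, hr₀, hball⟩ := Metric.isOpen_iff.mp (hF.isOpen_piece 0 y) y
    (mem_piece (n := 0) hy)
  have hsmall : Tendsto (fun m : ℕ => r₀ / (m + 1)) atTop (𝓝 0) := by
    simpa [div_eq_mul_inv] using tendsto_one_div_add_atTop_nhds_zero_nat.const_mul r₀
  -- `P m c l` records a branching event at a time `i ≥ m`: a connected set joins `F^[i] z` to `c`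
  -- and lands in a shrinking disk at `y` after `l` steps.
  set P : ℕ → ℂ → ℕ → Prop := fun m c l => ∃ i ≥ m, ∃ S : Set ℂ, IsPreconnected S ∧ c ∈ S ∧
    F^[i] z ∈ S ∧ S ⊆ iterPreimage F U V l ∧ MapsTo F^[l] S (Metric.ball y (r₀ / (m + 1)))
    with hP
  have hex : ∀ m, ∃ c ∈ critPoints F U, ∃ l ∈ Ico 1 N, P m c l := by
    intro m
    have hr : 0 < r₀ / (m + 1) := by positivity
    have hle : r₀ / (m + 1) ≤ r₀ := div_le_self hr₀.le (by linarith [m.cast_nonneg (α := ℝ)])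
    have h1 := hbad _ hr ((Metric.ball_subset_ball hle).trans hball)
    push Not at h1
    obtain ⟨ρ, hρ, hnot⟩ := h1
    obtain ⟨k, ⟨hk, hnk⟩, hkm⟩ := (((mapClusterPt_iff_frequently.mp hclus _
      (Metric.ball_mem_nhds y (lt_min hρ hr))).and_eventually hnot).and_eventually
      (eventually_ge_atTop (m + N))).exists
    have hnb := hnk (Metric.ball_subset_ball (min_le_left _ _) hk)
    unfold UnbranchedPullback at hnb
    push Not at hnb
    obtain ⟨x, hx, i, hik, hcx⟩ := hnb
    set C := connectedComponentIn
      (piece F U V (0 + k) z ∩ F^[k] ⁻¹' Metric.ball y (r₀ / (m + 1))) z with hC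
    have hCsub : C ⊆ piece F U V (0 + k) z ∩ F^[k] ⁻¹' Metric.ball y (r₀ / (m + 1)) :=
      connectedComponentIn_subset _ _
    have hl := hN k x (hCsub hx).1 i hik hcx
    have hzC : z ∈ C := mem_connectedComponentIn
      ⟨mem_piece (mem_iterPreimage_of_mem_filledJulia hz _),
        Metric.ball_subset_ball (min_le_right _ _) hk⟩
    have hkl : 0 + k = k - i + i := by omega
    have hCi : C ⊆ iterPreimage F U V (k - i + i) := by
      rw [← hkl]
      exact fun v hv => piece_subset _ _ (hCsub hv).1
    refine ⟨F^[i] x, hcx, k - i, ⟨by omega, hl⟩, i, by omega, F^[i] '' C, ?_,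
      mem_image_of_mem _ hx, mem_image_of_mem _ hzC, ?_, ?_⟩
    · exact isPreconnected_connectedComponentIn.image _
        ((hF.differentiableOn_iterate i).continuousOn.mono
          (hCi.trans (hF.iterPreimage_antitone (by omega))))
    · rintro _ ⟨v, hv, rfl⟩
      exact iterate_mem_iterPreimage (hCi hv)
    · rintro _ ⟨v, hv, rfl⟩
      rw [← Function.iterate_add_apply, Nat.sub_add_cancel hik.le]
      exact (hCsub hv).2
  -- Pigeonhole over the finitely many critical points and delays `l < N`.
  obtain ⟨c, hcc, l, hl, hfreq⟩ : ∃ c ∈ critPoints F U, ∃ l ∈ Ico 1 N, ∃ᶠ m in atTop, P m c l := by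
    by_contra hcon
    push Not at hcon
    obtain ⟨m, hm⟩ := ((eventually_all_finite hF.finite_crit).mpr fun c hc =>
      (eventually_all_finite (finite_Ico 1 N)).mpr fun l hl =>
        hcon c hc l hl).exists
    obtain ⟨c, hc, l, hl, h⟩ := hex m
    exact hm c hc l hl h
  obtain ⟨-, -, -, S₀, -, hcS₀, -, hS₀l, -⟩ := hfreq.exists
  have hcl : c ∈ iterPreimage F U V l := hS₀l hcS₀
  have hlc : F^[l] c = y := by
    by_contra hne
    obtain ⟨m, ⟨-, -, S, -, hcS, -, -, hSb⟩, hm⟩ := (hfreq.and_eventually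
      (hsmall.eventually_lt_const (dist_pos.mpr hne))).exists
    exact absurd (Metric.mem_ball.mp (hSb hcS)) (not_lt.mpr hm.le)
  refine ⟨c, hcc, l, hl.1, hcl, hlc, mapClusterPt_iff_frequently.mpr fun s hs => ?_⟩
  have hne := (tendsto_nhdsWithin_iff.mp (hF.tendsto_iterate_nhdsNE hcl)).2
  rw [eventually_nhdsWithin_iff] at hne
  obtain ⟨ε, hε, hεs⟩ := Metric.nhds_basis_closedBall.mem_iff.mp
    (inter_mem (inter_mem hs ((hF.isOpen_iterPreimage l).mem_nhds hcl)) hne)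
  have hsph : IsCompact (F^[l] '' Metric.sphere c ε) := (isCompact_sphere c ε).image_of_continuousOn
    ((hF.differentiableOn_iterate l).continuousOn.mono
      fun v hv => (hεs (Metric.sphere_subset_closedBall hv)).1.2)
  have hysph : y ∉ F^[l] '' Metric.sphere c ε := by
    rintro ⟨v, hv, hvy⟩
    refine (hεs (Metric.sphere_subset_closedBall hv)).2 (fun h => ?_) (hvy.trans hlc.symm)
    rw [mem_singleton_iff.mp h, Metric.mem_sphere, dist_self] at hv
    exact hε.ne hv
  obtain ⟨δ, hδ, hδs⟩ := Metric.isOpen_iff.mp hsph.isClosed.isOpen_compl y hysph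
  refine frequently_atTop.mpr fun m₀ => ?_
  obtain ⟨m, ⟨⟨i, him, S, hS, hcS, hzS, -, hSb⟩, hm⟩, hmm⟩ := ((hfreq.and_eventually
    (hsmall.eventually_lt_const hδ)).and_eventually (eventually_ge_atTop m₀)).exists
  refine ⟨i, hmm.trans him, ?_⟩
  -- On the sphere of radius `ε` the iterate stays away from `y`, so a connected set through `c`
  -- that lands near `y` cannot cross it. This traps `F^[i] z` near `c`.
  have hSball : S ⊆ Metric.ball c ε := by
    refine hS.subset_of_disjoint_frontier Metric.isOpen_ball ?_ ⟨c, hcS, Metric.mem_ball_self hε⟩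
    rw [frontier_ball c hε.ne']
    refine disjoint_left.mpr fun v hv hv' => ?_
    exact hδs (Metric.ball_subset_ball hm.le (hSb hv)) (mem_image_of_mem _ hv')
  exact (hεs (Metric.ball_subset_closedBall (hSball hzS))).1.1

/-- If the orbit of `z` stays away from the fibers of all non-escaping critical points, then it has
a limit point in `V` with a disk that pulls back without branching infinitely often, and branching
over the component of this limit point occurs only over finitely many values. -/
theorem IsComplexBoxMapping.exists_unbranchedPullback_of_noncritical
    (hF : IsComplexBoxMapping F U V) {z : ℂ} (hz : z ∈ ergodicSet F U V)
    (hS : ¬ ∃ c ∈ critPoints F U, c ∈ filledJulia F U V ∧ ∀ n, ∃ i, F^[i] z ∈ piece F U V n c) :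
    ∃ (y : ℂ) (r : ℝ) (E : Set ℂ), y ∈ V ∧ 0 < r ∧ Metric.ball y r ⊆ piece F U V 0 y ∧
      E.Finite ∧
      (∀ ρ > 0, ∃ᶠ k in atTop, F^[k] z ∈ Metric.ball y ρ ∧ UnbranchedPullback F U V 0 k z y r) ∧
      ∀ k, ∀ x ∈ piece F U V (0 + k) z, F^[k] x ∉ E → ∀ i < k, F^[i] x ∉ critPoints F U := by
  push Not at hS
  have hev : ∀ᶠ n in atTop, ∀ c ∈ critPoints F U, c ∈ iterPreimage F U V n →
      c ∈ filledJulia F U V ∧ ∀ i, F^[i] z ∉ piece F U V n c := by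
    refine (eventually_all_finite hF.finite_crit).mpr fun c hc => ?_
    by_cases hcK : c ∈ filledJulia F U V
    · obtain ⟨m, hm⟩ := hS c hc hcK
      filter_upwards [eventually_ge_atTop m] with n hn _
      exact ⟨hcK, fun i hi => hm i (hF.piece_antitone c hn hi)⟩
    · filter_upwards [hF.eventually_notMem_iterPreimage hcK] with n hn h
      exact absurd h hn
  obtain ⟨N, hN⟩ := hev.exists
  have hstep : ∀ k, ∀ x ∈ piece F U V (0 + k) z, ∀ i < k, F^[i] x ∈ critPoints F U →
      k - i < N := by
    intro k x hx i hik hcx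
    by_contra hle
    have h1 := hF.piece_antitone _ (show N ≤ 0 + (k - i) by omega)
      (hF.iterate_mem_piece_of_mem_piece hz.1 hik.le hx)
    exact (hN _ hcx (piece_subset _ _ h1)).2 i (mem_piece_comm h1
      (mem_iterPreimage_of_mem_filledJulia (iterate_mem_filledJulia hz.1 i) N))
  obtain ⟨y, hyV, r, hr, hball, hfreq⟩ : ∃ y ∈ V, ∃ r > 0, Metric.ball y r ⊆ piece F U V 0 y ∧
      ∀ ρ > 0, ∃ᶠ k in atTop, F^[k] z ∈ Metric.ball y ρ ∧ UnbranchedPullback F U V 0 k z y r := by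
    by_contra hcon
    push Not at hcon
    -- Each limit point in `V` is hit by a critical limit point after `l ≥ 1` steps, so the depth
    -- grows by at least one. At depth `N` the orbit of `z` would enter a critical piece that it
    -- must avoid.
    have hback : ∀ n, ∀ y ∈ iterPreimage F U V n, (MapClusterPt y atTop fun i => F^[i] z) →
        ∃ c ∈ critPoints F U, c ∈ iterPreimage F U V (n + 1) ∧
          MapClusterPt c atTop fun i => F^[i] z := by
      intro n y hy hclus
      have hyV : y ∈ V := hF.iterPreimage_antitone (Nat.zero_le n) hy
      obtain ⟨c, hcc, l, hl, hcl, hly, hcclus⟩ := hF.exists_critPoint_mapClusterPt hz.1 hstep hyV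
        hclus (fun r hr hb h => by
          obtain ⟨ρ, hρ, hnot⟩ := hcon y hyV r hr hb
          obtain ⟨k, hk, hk'⟩ := ((h ρ hρ).and_eventually hnot).exists
          exact hk' hk.1 hk.2)
      exact ⟨c, hcc, hF.iterPreimage_antitone (by omega)
        (mem_iterPreimage_add hcl (hly.symm ▸ hy)), hcclus⟩
    have hall : ∀ n, ∃ y ∈ iterPreimage F U V n, MapClusterPt y atTop fun i => F^[i] z := by
      intro n
      induction n with
      | zero =>
        exact hF.exists_mapClusterPt_of_notMem_boundaryPoints hz.1 fun h => hz.2 (Or.inl h)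
      | succ n ih =>
        obtain ⟨y, hy, hclus⟩ := ih
        obtain ⟨c, -, hc⟩ := hback n y hy hclus
        exact ⟨c, hc⟩
    obtain ⟨y, hy, hclus⟩ := hall N
    obtain ⟨c, hcc, hcN, hcclus⟩ := hback N y hy hclus
    have hcN' := hF.iterPreimage_antitone N.le_succ hcN
    obtain ⟨i, hi⟩ := (mapClusterPt_iff_frequently.mp hcclus _
      ((hF.isOpen_piece N c).mem_nhds (mem_piece hcN'))).exists
    exact (hN c hcc hcN').2 i hi
  -- Branching occurs fewer than `N` steps before arrival, so the branch values are images of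
  -- critical points under iterates of order below `N`.
  refine ⟨y, r, ⋃ l ∈ Iio N, F^[l] '' critPoints F U, hyV, hr, hball,
    (finite_Iio N).biUnion fun l _ => hF.finite_crit.image _, hfreq, ?_⟩
  intro k x hx hxE i hik hcx
  refine hxE (mem_iUnion₂.mpr ⟨k - i, hstep k x hx i hik hcx, F^[i] x, hcx, ?_⟩)
  rw [← Function.iterate_add_apply, Nat.sub_add_cancel hik.le]

theorem IsComplexBoxMapping.exists_isPuzzlePiece_diff_eq_zero (hF : IsComplexBoxMapping F U V)
    (hperm : NoPermutation F U) {X : Set ℂ} (hX : X ⊆ ergodicSet F U V)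
    (hXm : NullMeasurableSet X volume) (hFX : MapsTo F X X) (hpos : volume X ≠ 0) :
    ∃ J, IsPuzzlePiece F U V J ∧ volume (J \ X) = 0 := by
  obtain ⟨z, ⟨hzX, havoid⟩, hdens⟩ := exists_tendsto_measure_closedBall_diff hXm
    (fun _ h => h.1) (hF.volume_avoidsCriticalFibers_ne_zero hperm hX hFX hpos)
  have hz := hX hzX
  by_cases hS : ∃ c ∈ critPoints F U, c ∈ filledJulia F U V ∧
      ∀ n, ∃ i, F^[i] z ∈ piece F U V n c
  · obtain ⟨n, y, r, hy, hr, hball, hfreq, hcrit⟩ :=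
      hF.exists_unbranchedPullback_of_critical hperm hz havoid hS
    exact ⟨_, isPuzzlePiece_piece hy, hF.volume_piece_diff_eq_zero hperm hXm hFX hz.1 havoid
      hdens hr hball finite_empty hfreq fun k hk x hx _ => hcrit k hk x hx⟩
  · obtain ⟨y, r, E, hy, hr, hball, hE, hfreq, hcrit⟩ :=
      hF.exists_unbranchedPullback_of_noncritical hz hS
    exact ⟨_, isPuzzlePiece_piece (n := 0) hy, hF.volume_piece_diff_eq_zero hperm hXm hFX hz.1
      havoid hdens hr hball hE hfreq fun k _ => hcrit k⟩

end BoxMap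

theorem lemma4p3 (F : ℂ → ℂ) (U V : Set ℂ) (hF : BoxMap.IsComplexBoxMapping F U V)
    (hperm : BoxMap.NoPermutation F U) :
    MapsTo F (BoxMap.ergodicSet F U V) (BoxMap.ergodicSet F U V) ∧
    ∀ X' : Set ℂ, X' ⊆ BoxMap.ergodicSet F U V → NullMeasurableSet X' volume →
      MapsTo F X' X' → 0 < volume X' →
        ∃ J : Set ℂ, BoxMap.IsPuzzlePiece F U V J ∧ volume (J ∩ X') = volume J := by
  refine ⟨BoxMap.mapsTo_ergodicSet, fun X' hX' hmeas hmaps hpos => ?_⟩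
  obtain ⟨J, hJ, h0⟩ := hF.exists_isPuzzlePiece_diff_eq_zero hperm hX' hmeas hmaps hpos.ne'
  refine ⟨J, hJ, ?_⟩
  rw [← measure_inter_add_sdiff₀ J hmeas, h0, add_zero]
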